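/- \textbf{Notation.} Let $p,m_0,m$ be integers with $p\ge1$ and $m\ge m_0\ge1$. Boldface letters denote $p$-vectors; inequalities, absolute values $|\boldsymbol\beta|$ and products $\mathbf j\mathbf v$ of vectors are coordinatewise; $\mathbf 1=(1,\dots,1)$, $\mathbf 0=(0,\dots,0)$, and $\wedge\mathbf x$, $\vee\mathbf x$ are the smallest and the largest coordinate of $\mathbf x$. For multi-indices, $\|\boldsymbol\alpha\|=\alpha_1+\dots+\alpha_p$, $\boldsymbol\alpha!=\prod_r\alpha_r!$, $\mathbf x^{\boldsymbol\alpha}=\prod_r x_r^{\alpha_r}$, and $g^{(\boldsymbol\alpha)}$ is the corresponding partial derivative; $\sum_{\mathbf k=\mathbf a}^{\mathbf b}$ is the sum over integer vectors $\mathbf k$ with $\mathbf a\le\mathbf k\le\mathbf b$. For $J\subseteq[p]=\{1,\dots,p\}$, $\mathbf 1_J$ is the indicator vector of $J$, so that $\mathbf n\mathbf 1_J$ has coordinates $n_r$ for $r\in J$ and $0$ otherwise. For integers $l,j\ge1$ let $$\gamma_{l,j}=(-1)^{j-1}\frac2j\binom{2l}{l+j}\Big/\binom{2l}{l},\qquad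 \tau_{l,j}=\sum_{b=0}^{\lfloor (l-j)/2\rfloor}\gamma_{l,j+2b},\qquad \gamma_{l,\mathbf j}=\prod_{r}\gamma_{l,j_r},\qquad \tau_{l,\mathbf j}=\prod_r\tau_{l,j_r}.$$ For $F\colon\mathbb R^p\to\mathbb R$, $\mathbf n\in\mathbb Z_+^p$ and $J\subseteq[p]$ let $$A^J_{l,F}(\mathbf n)=\sum_{\mathbf j=\mathbf 1}^{l\mathbf 1}\gamma_{l,\mathbf j}\sum_{\mathbf i=\mathbf 0}^{\mathbf j-\mathbf 1}F(\mathbf n\mathbf 1_J-\mathbf 1+\mathbf j/2-\mathbf i),\qquad \tilde A_{l,F}(\mathbf n)=\sum_{\emptyset\ne J\subseteq[p]}(-1)^{p-|J|}A^J_{l,F}(\mathbf n).$$ \textbf{Theorem.} Let $f\colon\mathbb R^p\to\mathbb R$ be $2m$ times continuously differentiable, and let $F\colon\mathbb R^p\to\mathbb R$ be a $2m_0$ times continuously differentiable antiderivative of $f$; that is, the mixed partial derivative $F^{(\mathbf 1)}$ of $F$, once in each coordinate (taken in some order), exists everywhere and equals $f$. Suppose that $$F^{(\boldsymbol\alpha)}(\mathbf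 x)\to0\quad\text{as }\vee\mathbf x\to\infty,\ \text{ for each }\boldsymbol\alpha\in\mathbb Z_+^p\text{ with }\|\boldsymbol\alpha\|=2m_0,$$ and that, for each $\boldsymbol\alpha\in\mathbb Z_+^p$ with $\|\boldsymbol\alpha\|=2m$, the sums $\sum_{\mathbf k=\mathbf 0}^{\mathbf n-\mathbf 1}f^{(\boldsymbol\alpha)}(\mathbf k+\mathbf u)$ converge as $\wedge\mathbf n\to\infty$, uniformly in $\mathbf u\in[-m/2,m/2]^p$; denote the limit by $\sum_{\mathbf k=\mathbf 0}^{\infty\mathbf 1}f^{(\boldsymbol\alpha)}(\mathbf k+\mathbf u)$. Then: (i) The following limit exists and has the stated value: $$\sum_{\mathbf k\ge\mathbf 0}^{\mathrm{Alt}}f(\mathbf k):=\lim_{\wedge\mathbf n\to\infty}\Big(\sum_{\mathbf k=\mathbf 0}^{\mathbf n-\mathbf 1}f(\mathbf k)-\tilde A_{m_0,F}(\mathbf n)\Big)=(-1)^pA^\emptyset_{m,F}(\mathbf 0)-R_{m,f}(\infty),$$ where $$R_{m,f}(\infty)=\frac m{2^{2m+p-1}}\sum_{\|\boldsymbol\alpha\|=2m}\frac1{\boldsymbol\alpha!}\int_0^1ds\,(1-s)^{2m-1}\int_{[-1,1]^p}d\mathbf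 v\,\mathbf v^{\boldsymbol\alpha}\sum_{\mathbf j=\mathbf 1}^{m\mathbf 1}\gamma_{m,\mathbf j}\,\mathbf j^{\boldsymbol\alpha+\mathbf 1}\sum_{\mathbf k=\mathbf 0}^{\infty\mathbf 1}f^{(\boldsymbol\alpha)}(\mathbf k+s\mathbf j\mathbf v/2).$$ (ii) For all integers $l\ge1$, all $J\subseteq[p]$ and all $\mathbf n\in\mathbb Z_+^p$, $$A^J_{l,F}(\mathbf n)=\sum_{\boldsymbol\beta=(1-l)\mathbf 1}^{(l-1)\mathbf 1}\tau_{l,\mathbf 1+|\boldsymbol\beta|}\,F(\mathbf n\mathbf 1_J-\mathbf 1/2-\boldsymbol\beta/2)=\sum_{\boldsymbol\alpha=\mathbf 0}^{(l-1)\mathbf 1}\tau_{l,\mathbf 1+\boldsymbol\alpha}\sum_{\boldsymbol\beta\in\mathbb Z^p\colon|\boldsymbol\beta|=\boldsymbol\alpha}F(\mathbf n\mathbf 1_J-\mathbf 1/2-\boldsymbol\beta/2).$$ (iii) If $M$ is a real number such that $\big|\sum_{\mathbf k=\mathbf 0}^{\mathbf n-\mathbf 1}f^{(\boldsymbol\alpha)}(\mathbf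 k+\mathbf u)\big|\le M$ for all $\mathbf n\in\mathbb Z_+^p$, all $\boldsymbol\alpha$ with $\|\boldsymbol\alpha\|=2m$ and all $\mathbf u\in(-m/2,m/2]^p$, then $$|R_{m,f}(\infty)|\le\frac M{2^{2m}}\sum_{\|\boldsymbol\alpha\|=2m}\frac1{(\boldsymbol\alpha+\mathbf 1)!}\sum_{\mathbf j=\mathbf 1}^{m\mathbf 1}|\gamma_{m,\mathbf j}|\,\mathbf j^{\boldsymbol\alpha+\mathbf 1}\le M\,\frac{1.0331\,(\pi m)^{(p+1)/2}}{(2m+1)!}\,(\kappa pm)^{2m},$$ where $\kappa=\sqrt{\Lambda_*/4}$ and $\Lambda_*=\max_{0<t<1}(1-t)^{t-1}(1+t)^{-1-t}t^2$; if $m\ge2$, the factor $1.0331$ can be replaced by $1.001$. (iv) For all integers $l\ge1$, all $J\subseteq[p]$ and all $\mathbf n\in\mathbb Z_+^p$, $$A^\emptyset_{l,F}(\mathbf 0)=A^\emptyset_{l,F}(\mathbf n)=A^J_{l,F}(\mathbf 0)=\sum_{\boldsymbol\alpha=\mathbf 0}^{(l-1)\mathbf 1}\tau_{l,\mathbf 1+\boldsymbol\alpha}\sum_{\boldsymbol\beta\in\mathbb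 Z^p\colon|\boldsymbol\beta|=\boldsymbol\alpha}F(\boldsymbol\beta/2-\mathbf 1/2).$$ -/

import Mathlib

noncomputable section

namespace AltSum

/-- The filter on `ℕ^p` describing `min n → ∞`. -/
def minToInfty (p : ℕ) : Filter (Fin p → ℕ) :=
  Filter.comap (fun n : Fin p → ℕ => ⨅ r, n r) Filter.atTop

/-- The filter on `ℝ^p` describing `max x → ∞` (the largest coordinate tends to `+∞`). -/
def maxToInfty (p : ℕ) : Filter (Fin p → ℝ) :=
  Filter.comap (fun x : Fin p → ℝ => ⨆ r, x r) Filter.atTop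

/-- The partial derivative in the `r`-th coordinate. -/
def partialDeriv {p : ℕ} (r : Fin p) (g : (Fin p → ℝ) → ℝ) : (Fin p → ℝ) → ℝ :=
  fun x => lineDeriv ℝ g x (Pi.single r 1)

/-- The partial derivative `g^(α) = ∂₁^α₁ ⋯ ∂ₚ^αₚ g` for a multi-index `α`. -/
def multiDeriv {p : ℕ} (α : Fin p → ℕ) (g : (Fin p → ℝ) → ℝ) : (Fin p → ℝ) → ℝ :=
  (List.finRange p).foldr (fun r h => (partialDeriv r)^[α r] h) g

/-- `F` is an antiderivative of `f`: the mixed partial derivative of `F`, once in each of the `p`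
coordinates (in some order `σ`), exists everywhere and equals `f`.  The functions
`G 0 = F, G 1, …, G p = f` are the successive partial derivatives. -/
def IsAntiderivative {p : ℕ} (F f : (Fin p → ℝ) → ℝ) : Prop :=
  ∃ (σ : Equiv.Perm (Fin p)) (G : Fin (p + 1) → (Fin p → ℝ) → ℝ),
    G 0 = F ∧ G (Fin.last p) = f ∧
      ∀ (r : Fin p) (x : Fin p → ℝ),
        HasLineDerivAt ℝ (G r.castSucc) (G r.succ x) x (Pi.single (σ r) 1)

/-- The multi-indices `k` with `0 ≤ k ≤ n - 1`; empty if some `n r = 0`. -/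
def box {p : ℕ} (n : Fin p → ℕ) : Finset (Fin p → ℕ) :=
  Fintype.piFinset fun r => Finset.range (n r)

/-- The partial sum of `g (k + u)` over `0 ≤ k ≤ n - 1`. -/
def shiftedSum {p : ℕ} (g : (Fin p → ℝ) → ℝ) (n : Fin p → ℕ) (u : Fin p → ℝ) : ℝ :=
  ∑ k ∈ box n, g (fun r => (k r : ℝ) + u r)

/-- The sum of the multi-index series of the `g (k + u)` over all `k ≥ 0`, as the limit of the
partial sums over `0 ≤ k ≤ n - 1` when `min n → ∞`. -/
def shiftedSeries {p : ℕ} (g : (Fin p → ℝ) → ℝ) (u : Fin p → ℝ) : ℝ :=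
  Filter.limUnder (minToInfty p) fun n => shiftedSum g n u

/-- The coefficient `γ_{m,j}` for an integer `j ≥ 1`. -/
def gamma1 (m j : ℕ) : ℝ :=
  (-1) ^ (j - 1) * (2 / (j : ℝ)) * (((2 * m).choose (m + j) : ℝ) / ((2 * m).choose m : ℝ))

/-- The coefficient `γ_{m,j}` for a multi-index `j`. -/
def gammaCoeff {p : ℕ} (m : ℕ) (j : Fin p → ℕ) : ℝ := ∏ r, gamma1 m (j r)

/-- The coefficient `τ_{m,j}` for an integer `1 ≤ j ≤ m`. -/
def tau1 (m j : ℕ) : ℝ := ∑ b ∈ Finset.range ((m - j) / 2 + 1), gamma1 m (j + 2 * b)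

/-- The coefficient `τ_{m,j}` for a multi-index `j`. -/
def tauCoeff {p : ℕ} (m : ℕ) (j : Fin p → ℕ) : ℝ := ∏ r, tau1 m (j r)

/-- `n 1_J`, as a point of `ℝ^p`. -/
def restrictTo {p : ℕ} (J : Finset (Fin p)) (n : Fin p → ℕ) : Fin p → ℝ :=
  fun r => if r ∈ J then (n r : ℝ) else 0

/-- `A^J_{m,F}(n)`. -/
def AJ {p : ℕ} (m : ℕ) (F : (Fin p → ℝ) → ℝ) (J : Finset (Fin p)) (n : Fin p → ℕ) : ℝ :=
  ∑ j ∈ Finset.Icc (1 : Fin p → ℕ) (fun _ => m), gammaCoeff m j *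
    ∑ i ∈ box j, F (fun r => restrictTo J n r - 1 + (j r : ℝ) / 2 - (i r : ℝ))

/-- `Ã_{m,F}(n)`. -/
def tildeA {p : ℕ} (m : ℕ) (F : (Fin p → ℝ) → ℝ) (n : Fin p → ℕ) : ℝ :=
  ∑ J ∈ (Finset.univ : Finset (Finset (Fin p))).erase ∅, (-1) ^ (p - J.card) * AJ m F J n

/-- The generalized sum of the series of the `f k`, `k ≥ 0`. -/
def altSum {p : ℕ} (m₀ : ℕ) (F f : (Fin p → ℝ) → ℝ) : ℝ :=
  Filter.limUnder (minToInfty p) fun n => (∑ k ∈ box n, f (fun r => (k r : ℝ))) - tildeA m₀ F n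

/-- The finite set of all `β ∈ ℤ^p` with `|β| = α` coordinatewise. -/
def absFiber {p : ℕ} (α : Fin p → ℕ) : Finset (Fin p → ℤ) :=
  (Finset.Icc (fun r => -(α r : ℤ)) (fun r => (α r : ℤ))).filter fun β => ∀ r, (β r).natAbs = α r

/-- The multi-indices `α` with `α₁ + ⋯ + αₚ = d`. -/
def multiIndices (p d : ℕ) : Finset (Fin p → ℕ) := Finset.piAntidiag Finset.univ d

/-- The remainder `R_{m,f}(∞)`. -/
def remainderInfty {p : ℕ} (m : ℕ) (f : (Fin p → ℝ) → ℝ) : ℝ :=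
  (m : ℝ) / 2 ^ (2 * m + p - 1) *
    ∑ α ∈ multiIndices p (2 * m), 1 / (∏ r, ((α r).factorial : ℝ)) *
      ∫ s in (0 : ℝ)..1, (1 - s) ^ (2 * m - 1) *
        ∫ v in Set.Icc (-1 : Fin p → ℝ) 1, (∏ r, v r ^ α r) *
          ∑ j ∈ Finset.Icc (1 : Fin p → ℕ) (fun _ => m),
            gammaCoeff m j * (∏ r, (j r : ℝ) ^ (α r + 1)) *
              shiftedSeries (multiDeriv α f) (fun r => s * (j r : ℝ) * v r / 2)

/-- `Λ(t) = (1 - t)^(t - 1) (1 + t)^(-1 - t) t²`, for `0 < t < 1`. -/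
def Lam (t : ℝ) : ℝ := (1 - t) ^ (t - 1) * (1 + t) ^ (-1 - t) * t ^ 2

/-- `Λ_*`, the maximum of `Λ` over the interval `(0,1)`. -/
def LamStar : ℝ := sSup (Lam '' Set.Ioo 0 1)

/-- `κ = √(Λ_* / 4)`. -/
def kappa : ℝ := Real.sqrt (LamStar / 4)

/-- The sharper of the two upper bounds on the remainder. -/
def remainderBound (p m : ℕ) (M : ℝ) : ℝ :=
  M / 2 ^ (2 * m) *
    ∑ α ∈ multiIndices p (2 * m), 1 / (∏ r, ((α r + 1).factorial : ℝ)) *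
      ∑ j ∈ Finset.Icc (1 : Fin p → ℕ) (fun _ => m),
        |gammaCoeff m j| * ∏ r, (j r : ℝ) ^ (α r + 1)

/-- The simpler of the two upper bounds on the remainder, with numerical factor `c`. -/
def simpleBound (c : ℝ) (p m : ℕ) (M : ℝ) : ℝ :=
  M * (c * (Real.pi * m) ^ (((p : ℝ) + 1) / 2) / ((2 * m + 1).factorial : ℝ)) *
    (kappa * p * m) ^ (2 * m)

end AltSum

end

/-!
The box integrals `∫_{[-j/2, j/2]} φ`, combined with the coefficients `γ_{m,j}`, reproduce `φ(0)`
for every polynomial `φ` of degree less than `2m`, because in one variable the coefficients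
annihilate the even moments of orders `2, …, 2m - 2`. Applied to `φ = ∑_{k < n} f(k + ·)`, they give
`∑_{k < n} f(k)` up to the integral remainder of Taylor's formula of order `2m`. On the other hand,
the integral of a mixed derivative over a box is an alternating sum over its vertices, and summation
over `k` telescopes, so that the same combination equals an alternating sum of the values
`A^J_{m,F}(n)`. Replacing `A^J_{m,F}` by `A^J_{m₀,F}` for `J ≠ ∅` changes it by a functional that
kills polynomials of degree less than `2m₀`, hence by Taylor remainders of `F` which vanish in the
limit. The numerical bound on the remainder comes from Stirling's formula, which estimates the
ratios `binom(2m, m+j) / binom(2m, m)`, and from the maximality of `Λ_*`.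
-/

namespace AltSum

open Finset Real Filter MeasureTheory
open scoped Topology

/-! ### Stirling estimates and the constant `Λ_*` -/

theorem two_mul_le_add_of_antitone_sub {u : ℕ → ℝ} (hu : Antitone fun n => u n - u (n + 1))
    (k j : ℕ) : 2 * u (k + j) ≤ u k + u (k + 2 * j) := by
  induction j generalizing k with
  | zero => exact (two_mul (u k)).le
  | succ j ih =>
    have outer : u (k + 1 + 2 * j) - u (k + 1 + 2 * j + 1) ≤ u k - u (k + 1) := hu (by lia)
    have inner := ih (k + 1)
    rw [show k + (j + 1) = k + 1 + j by ring, show k + 2 * (j + 1) = k + 1 + 2 * j + 1 by ring]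
    linarith

theorem antitone_log_stirlingSeq_sub :
    Antitone fun n => log (Stirling.stirlingSeq (n + 1)) - log (Stirling.stirlingSeq (n + 2)) :=
  fun k n hkn => hasSum_le (fun i => by gcongr) (Stirling.log_stirlingSeq_sdiff_hasSum n)
    (Stirling.log_stirlingSeq_sdiff_hasSum k)

theorem stirlingSeq_pos {n : ℕ} (hn : n ≠ 0) : 0 < Stirling.stirlingSeq n := by
  obtain ⟨k, rfl⟩ := Nat.exists_eq_succ_of_ne_zero hn
  exact Stirling.stirlingSeq'_pos k

theorem sq_stirlingSeq_le_mul {a : ℕ} (ha : a ≠ 0) (j : ℕ) :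
    Stirling.stirlingSeq (a + j) ^ 2 ≤
      Stirling.stirlingSeq a * Stirling.stirlingSeq (a + 2 * j) := by
  have hpos (i : ℕ) : 0 < Stirling.stirlingSeq (a + i) := stirlingSeq_pos (by lia)
  have ha_pos : 0 < Stirling.stirlingSeq a := stirlingSeq_pos ha
  rw [← log_le_log_iff (pow_pos (hpos j) 2) (mul_pos ha_pos (hpos (2 * j))), log_pow,
    log_mul ha_pos.ne' (hpos (2 * j)).ne']
  obtain ⟨k, rfl⟩ := Nat.exists_eq_succ_of_ne_zero ha
  simpa only [Nat.succ_eq_add_one, add_right_comm k, Nat.cast_ofNat] using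
    two_mul_le_add_of_antitone_sub antitone_log_stirlingSeq_sub k j

/-- The elementary factor in Stirling's formula, for which
`n! = Stirling.stirlingSeq n * stirlingMain n` when `n ≠ 0`. -/
noncomputable def stirlingMain (n : ℕ) : ℝ := √(2 * n) * (n / exp 1) ^ n

theorem stirlingMain_pos {n : ℕ} (hn : n ≠ 0) : 0 < stirlingMain n := by
  unfold stirlingMain; positivity

theorem factorial_eq_stirlingSeq_mul {n : ℕ} (hn : n ≠ 0) :
    (n.factorial : ℝ) = Stirling.stirlingSeq n * stirlingMain n :=
  (div_mul_cancel₀ _ (stirlingMain_pos hn).ne').symm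

theorem sq_factorial_div_le {a : ℕ} (ha : a ≠ 0) (j : ℕ) :
    ((a + j).factorial : ℝ) ^ 2 / (a.factorial * (a + 2 * j).factorial) ≤
      stirlingMain (a + j) ^ 2 / (stirlingMain a * stirlingMain (a + 2 * j)) := by
  have hpos : 0 < stirlingMain a := stirlingMain_pos ha
  have hpos' : 0 < stirlingMain (a + 2 * j) := stirlingMain_pos (by lia)
  rw [factorial_eq_stirlingSeq_mul ha, factorial_eq_stirlingSeq_mul (by lia : a + j ≠ 0),
    factorial_eq_stirlingSeq_mul (by lia : a + 2 * j ≠ 0), mul_pow, mul_mul_mul_comm,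
    mul_div_mul_comm]
  refine mul_le_of_le_one_left (by positivity) (div_le_one_of_le₀ (sq_stirlingSeq_le_mul ha j) ?_)
  exact (mul_pos (stirlingSeq_pos ha) (stirlingSeq_pos (by lia))).le

theorem Lam_pow_eq {a : ℕ} (ha : a ≠ 0) (j : ℕ) :
    Lam (j / (a + j)) ^ (a + j) =
      (j : ℝ) ^ (2 * (a + j)) / ((a : ℝ) ^ a * (a + 2 * j) ^ (a + 2 * j)) := by
  have : (0 : ℝ) < a := by positivity
  have one_sub : 1 - (j : ℝ) / (a + j) = a / (a + j) := by field_simp; ring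
  have one_add : 1 + (j : ℝ) / (a + j) = (a + 2 * j) / (a + j) := by field_simp; ring
  have exponent_sub : ((j : ℝ) / (a + j) - 1) * (a + j : ℕ) = -a := by
    push_cast; field_simp; ring
  have exponent_add : (-1 - (j : ℝ) / (a + j)) * (a + j : ℕ) = -(a + 2 * j : ℕ) := by
    push_cast; field_simp; ring
  rw [Lam, mul_pow, mul_pow, one_sub, one_add, ← rpow_mul_natCast (by positivity),
    ← rpow_mul_natCast (by positivity), exponent_sub, exponent_add, rpow_neg (by positivity),
    rpow_neg (by positivity), rpow_natCast, rpow_natCast, ← pow_mul, div_pow, div_pow, div_pow,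
    show 2 * (a + j) = a + (a + 2 * j) by ring, pow_add (a + j : ℝ)]
  field_simp
  ring

theorem sq_stirlingMain_div_mul_pow {a : ℕ} (ha : a ≠ 0) (j : ℕ) :
    stirlingMain (a + j) ^ 2 / (stirlingMain a * stirlingMain (a + 2 * j)) *
        (j : ℝ) ^ (2 * (a + j)) =
      (a + j) ^ (2 * (a + j)) * Lam (j / (a + j)) ^ (a + j) *
        (1 / √(1 - ((j : ℝ) / (a + j)) ^ 2)) := by
  have : (0 : ℝ) < a := by positivity
  have sqrt_num : √(2 * (a + j : ℝ)) ^ 2 = 2 * (a + j) := sq_sqrt (by positivity)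
  have sqrt_den : √(2 * a : ℝ) * √(2 * (a + 2 * j)) = 2 * √(a * (a + 2 * j)) := by
    rw [← sqrt_mul (by positivity), show (2 * a * (2 * (a + 2 * j)) : ℝ) =
      2 ^ 2 * (a * (a + 2 * j)) by ring, sqrt_mul (by positivity), sqrt_sq (by norm_num)]
  have sqrt_sub : √(1 - ((j : ℝ) / (a + j)) ^ 2) = √(a * (a + 2 * j)) / (a + j) := by
    rw [show 1 - ((j : ℝ) / (a + j)) ^ 2 = a * (a + 2 * j) / (a + j) ^ 2 by field_simp; ring,
      sqrt_div (by positivity), sqrt_sq (by positivity)]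
  have exp_pow : exp 1 ^ (2 * (a + j)) = exp 1 ^ a * exp 1 ^ (a + 2 * j) := by
    rw [← pow_add]; ring_nf
  rw [Lam_pow_eq ha, sqrt_sub]
  simp only [stirlingMain, Nat.cast_add, Nat.cast_mul, Nat.cast_ofNat]
  rw [mul_pow, sqrt_num, mul_mul_mul_comm, sqrt_den, ← pow_mul, mul_comm (a + j) 2, div_pow,
    div_pow, div_pow, exp_pow]
  field_simp

theorem Lam_nonneg {t : ℝ} (ht : t ∈ Set.Ioo (0 : ℝ) 1) : 0 ≤ Lam t := by
  have := sub_pos.2 ht.2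
  have := ht.1
  unfold Lam; positivity

theorem Lam_le_exp_one {t : ℝ} (ht : t ∈ Set.Ioo (0 : ℝ) 1) : Lam t ≤ exp 1 := by
  obtain ⟨h0, h1⟩ := ht
  have ht' : 0 < 1 - t := sub_pos.2 h1
  have first : (1 - t) ^ (t - 1) ≤ exp 1 := by
    rw [rpow_def_of_pos ht', exp_le_exp]
    have : negMulLog (1 - t) ≤ 1 - (1 - t) := negMulLog_le_one_sub_self ht'.le
    rw [negMulLog] at this
    linarith
  have second : (1 + t) ^ (-1 - t) ≤ 1 :=
    rpow_le_one_of_one_le_of_nonpos (by linarith) (by linarith)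
  have third : t ^ 2 ≤ 1 := pow_le_one₀ h0.le h1.le
  calc Lam t ≤ exp 1 * 1 * 1 := by unfold Lam; gcongr
    _ = exp 1 := by ring

theorem Lam_le_LamStar {t : ℝ} (ht : t ∈ Set.Ioo (0 : ℝ) 1) : Lam t ≤ LamStar :=
  le_csSup ⟨exp 1, Set.forall_mem_image.2 fun _ => Lam_le_exp_one⟩ ⟨t, ht, rfl⟩

theorem LamStar_gt_d5 : (0.30812 : ℝ) < LamStar := by
  -- The maximum is attained near `5 / 6`, and `Λ(5/6)⁶ = 5¹² / 11¹¹` is rational.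
  have hmem : (5 / 6 : ℝ) ∈ Set.Ioo 0 1 := by norm_num
  refine lt_of_lt_of_le ?_ (Lam_le_LamStar hmem)
  have hpow := Lam_pow_eq one_ne_zero 5
  norm_num at hpow
  refine lt_of_pow_lt_pow_left₀ 6 (Lam_nonneg hmem) ?_
  rw [hpow]; norm_num

theorem LamStar_pos : 0 < LamStar := by linarith [LamStar_gt_d5]

/-! ### Absolute sums of the coefficients `γ_{m,j}` -/

theorem sum_range_two_mul_add_one {M : Type*} [AddCommMonoid M] (h : ℕ → M) (m : ℕ) :
    ∑ i ∈ range (2 * m + 1), h i = h m + ∑ j ∈ Icc 1 m, (h (m + j) + h (m - j)) := by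
  have upper : ∑ j ∈ Icc 1 m, h (m + j) = ∑ i ∈ Ico (m + 1) (2 * m + 1), h i := by
    rw [← Ico_add_one_right_eq_Icc, sum_Ico_add h 1 (m + 1) m]
    exact sum_congr (by congr 1 <;> ring) fun _ _ => rfl
  have lower : ∑ j ∈ Icc 1 m, h (m - j) = ∑ i ∈ range m, h i := by
    rw [← Ico_add_one_right_eq_Icc, sum_Ico_reflect h 1 le_rfl]
    simp
  rw [sum_add_distrib, upper, lower, range_eq_Ico, range_eq_Ico,
    ← sum_Ico_consecutive h (Nat.zero_le m) (by lia : m ≤ 2 * m + 1),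
    sum_eq_sum_Ico_succ_bot (by lia : m < 2 * m + 1)]
  abel

theorem abs_gamma1_mul_self {m j : ℕ} (hj : j ≠ 0) :
    |gamma1 m j| * j = 2 * (((2 * m).choose (m + j) : ℝ) / ((2 * m).choose m : ℝ)) := by
  have : (j : ℝ) ≠ 0 := by positivity
  simp only [gamma1, abs_mul, abs_pow, abs_neg, abs_one, one_pow, abs_div, Nat.abs_cast,
    Nat.abs_ofNat]
  field_simp

theorem choose_add_div_choose {m j : ℕ} (hj : j ≤ m) :
    ((2 * m).choose (m + j) : ℝ) / ((2 * m).choose m : ℝ) =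
      (m.factorial : ℝ) ^ 2 / ((m - j).factorial * (m + j).factorial) := by
  rw [Nat.cast_choose ℝ (by lia : m ≤ 2 * m), Nat.cast_choose ℝ (by lia : m + j ≤ 2 * m),
    show 2 * m - m = m by lia, show 2 * m - (m + j) = m - j by lia]
  field_simp

theorem sum_abs_gamma1_mul_self (m : ℕ) :
    ∑ j ∈ Icc 1 m, |gamma1 m j| * j = 4 ^ m / (m.centralBinom : ℝ) - 1 := by
  have total : (4 : ℝ) ^ m = ∑ i ∈ range (2 * m + 1), ((2 * m).choose i : ℝ) := by
    exact_mod_cast (by rw [Nat.sum_range_choose, pow_mul]; rfl :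
      4 ^ m = ∑ i ∈ range (2 * m + 1), (2 * m).choose i)
  have hc : ((2 * m).choose m : ℝ) ≠ 0 := by exact_mod_cast Nat.centralBinom_ne_zero m
  rw [total, sum_range_two_mul_add_one, Nat.centralBinom_eq_two_mul_choose, add_div, div_self hc,
    add_sub_cancel_left, sum_div]
  refine sum_congr rfl fun j hj => ?_
  obtain ⟨one_le, le_m⟩ := mem_Icc.1 hj
  rw [abs_gamma1_mul_self (by lia), Nat.choose_symm_of_eq_add (by lia : 2 * m = m - j + (m + j))]
  ring

theorem sq_four_pow_div_centralBinom_le (m : ℕ) :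
    (4 ^ m / (m.centralBinom : ℝ)) ^ 2 ≤ π * m + π / 2 := by
  have wallis := Real.Wallis.W_le m
  rw [Real.Wallis.W_eq_factorial_ratio, div_le_iff₀ (by positivity)] at wallis
  rw [Nat.centralBinom_eq_two_mul_choose, Nat.cast_choose ℝ (by lia : m ≤ 2 * m),
    show 2 * m - m = m by lia, div_pow, div_pow, div_div_eq_mul_div, div_le_iff₀ (by positivity)]
  calc ((4 : ℝ) ^ m) ^ 2 * (m.factorial * m.factorial : ℝ) ^ 2
      = 2 ^ (4 * m) * (m.factorial : ℝ) ^ 4 := by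
        rw [show (4 : ℝ) = 2 ^ 2 by norm_num, ← pow_mul, ← pow_mul]; ring
    _ ≤ π / 2 * ((2 * m).factorial ^ 2 * (2 * m + 1)) := wallis
    _ = _ := by ring

theorem sum_abs_gamma1_mul_self_le {m : ℕ} (hm : m ≠ 0) :
    ∑ j ∈ Icc 1 m, |gamma1 m j| * j ≤ √(π * m) := by
  have hm_one : (1 : ℝ) ≤ m := by exact_mod_cast Nat.one_le_iff_ne_zero.2 hm
  have one_le_sqrt : 1 ≤ √(π * m) := by rw [one_le_sqrt]; nlinarith [pi_gt_three]
  have sq_sqrt : √(π * m) ^ 2 = π * m := sq_sqrt (by positivity)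
  rw [sum_abs_gamma1_mul_self, sub_le_iff_le_add]
  refine le_of_sq_le_sq ((sq_four_pow_div_centralBinom_le m).trans ?_) (by positivity)
  nlinarith [pi_lt_four]

theorem sub_div_sqrt_le_arcsin_sub {s t : ℝ} (hs : 0 ≤ s) (hst : s < t) (ht : t ≤ 1) :
    1 / √(1 - s ^ 2) * (t - s) ≤ arcsin t - arcsin s := by
  have deriv_arcsin (x : ℝ) (hx : x ∈ interior (Set.Icc s t)) :
      HasDerivAt arcsin (1 / √(1 - x ^ 2)) x := by
    rw [interior_Icc] at hx
    exact hasDerivAt_arcsin (by linarith [hx.1]) (by linarith [hx.2])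
  refine (convex_Icc s t).mul_sub_le_image_sub_of_le_deriv continuous_arcsin.continuousOn
    (fun x hx => (deriv_arcsin x hx).differentiableAt.differentiableWithinAt) (fun x hx => ?_)
    s (Set.left_mem_Icc.2 hst.le) t (Set.right_mem_Icc.2 hst.le) hst.le
  rw [(deriv_arcsin x hx).deriv]
  obtain ⟨hsx, hxt⟩ := interior_Icc.subset hx
  have : 0 < 1 - x ^ 2 := by nlinarith
  gcongr

theorem sum_one_div_sqrt_one_sub_sq_le {m : ℕ} (hm : m ≠ 0) :
    ∑ j ∈ Ico 1 m, 1 / √(1 - ((j : ℝ) / m) ^ 2) ≤ m * (π / 2) - 1 := by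
  have hm_pos : (0 : ℝ) < m := by positivity
  have term_le : ∀ j ∈ Ico 1 m, 1 / √(1 - ((j : ℝ) / m) ^ 2) ≤
      m * (arcsin (((j + 1 : ℕ) : ℝ) / m) - arcsin ((j : ℝ) / m)) := by
    intro j hj
    have hjm : ((j + 1 : ℕ) : ℝ) / m ≤ 1 :=
      div_le_one_of_le₀ (by exact_mod_cast (mem_Ico.1 hj).2) hm_pos.le
    have slope := sub_div_sqrt_le_arcsin_sub (s := (j : ℝ) / m) (by positivity)
      (by gcongr; exact j.lt_succ_self) hjm
    rw [← sub_div, Nat.cast_succ, add_sub_cancel_left] at slope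
    calc 1 / √(1 - ((j : ℝ) / m) ^ 2) = m * (1 / √(1 - ((j : ℝ) / m) ^ 2) * (1 / m)) := by
          field_simp
      _ ≤ _ := by rw [Nat.cast_succ]; gcongr
  have le_arcsin : 1 ≤ m * arcsin (1 / m) := by
    have hle : (1 : ℝ) / m ≤ 1 :=
      div_le_one_of_le₀ (by exact_mod_cast Nat.one_le_iff_ne_zero.2 hm) hm_pos.le
    have hnonneg : (0 : ℝ) ≤ 1 / m := by positivity
    rw [← div_le_iff₀' hm_pos]
    simpa only [sin_arcsin (by linarith) hle] using sin_le (arcsin_nonneg.2 hnonneg)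
  refine (sum_le_sum term_le).trans ?_
  rw [← mul_sum, sum_Ico_sub (fun j : ℕ => arcsin ((j : ℝ) / m)) (by lia), div_self hm_pos.ne',
    arcsin_one, Nat.cast_one]
  linarith

theorem one_le_centralBinom_mul_LamStar_pow {m : ℕ} (hm : 8 ≤ m) :
    1 ≤ (m.centralBinom : ℝ) * LamStar ^ m := by
  have hL := LamStar_gt_d5
  induction m, hm using Nat.le_induction with
  | base =>
    rw [show Nat.centralBinom 8 = 12870 by decide]
    calc (1 : ℝ) ≤ 12870 * 0.30812 ^ 8 := by norm_num
      _ ≤ (12870 : ℕ) * LamStar ^ 8 := by push_cast; gcongr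
  | succ n hn ih =>
    have rec_eq : ((n : ℝ) + 1) * (n + 1).centralBinom = 2 * (2 * n + 1) * n.centralBinom := by
      exact_mod_cast Nat.succ_mul_centralBinom_succ n
    have hn' : (8 : ℝ) ≤ n := by exact_mod_cast hn
    refine le_of_mul_le_mul_left ?_ (by positivity : (0 : ℝ) < n + 1)
    calc ((n : ℝ) + 1) * 1 ≤ (2 * (2 * n + 1) * 0.30812) * 1 := by linarith
      _ ≤ (2 * (2 * n + 1) * LamStar) * (n.centralBinom * LamStar ^ n) := by gcongr
      _ = (n + 1) * ((n + 1).centralBinom * LamStar ^ (n + 1)) := by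
          rw [← mul_assoc ((n : ℝ) + 1), rec_eq]; ring

theorem choose_add_div_choose_mul_pow_le {m j : ℕ} (hj : j ≠ 0) (hjm : j < m) :
    ((2 * m).choose (m + j) : ℝ) / ((2 * m).choose m : ℝ) * (j : ℝ) ^ (2 * m) ≤
      (m : ℝ) ^ (2 * m) * LamStar ^ m * (1 / √(1 - ((j : ℝ) / m) ^ 2)) := by
  rw [choose_add_div_choose hjm.le]
  obtain ⟨a, rfl⟩ : ∃ a, m = a + j := ⟨m - j, by lia⟩
  have ha : a ≠ 0 := by lia
  have : (0 : ℝ) < a := by positivity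
  have hmem : (j : ℝ) / (a + j) ∈ Set.Ioo (0 : ℝ) 1 :=
    ⟨by positivity, (div_lt_one (by positivity)).2 (by linarith)⟩
  rw [Nat.add_sub_cancel, add_assoc, ← two_mul, Nat.cast_add]
  calc _ ≤ stirlingMain (a + j) ^ 2 / (stirlingMain a * stirlingMain (a + 2 * j)) *
        (j : ℝ) ^ (2 * (a + j)) :=
        mul_le_mul_of_nonneg_right (sq_factorial_div_le ha j) (by positivity)
    _ = (a + j) ^ (2 * (a + j)) * Lam (j / (a + j)) ^ (a + j) *
        (1 / √(1 - ((j : ℝ) / (a + j)) ^ 2)) := sq_stirlingMain_div_mul_pow ha j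
    _ ≤ _ := by gcongr; exacts [Lam_nonneg hmem, Lam_le_LamStar hmem]

theorem sum_abs_gamma1_mul_pow_eq (m k : ℕ) :
    ∑ j ∈ Icc 1 m, |gamma1 m j| * (j : ℝ) ^ (k + 1) =
      2 * ∑ j ∈ Icc 1 m, ((2 * m).choose (m + j) : ℝ) / ((2 * m).choose m : ℝ) * (j : ℝ) ^ k := by
  rw [mul_sum]
  refine sum_congr rfl fun j hj => ?_
  rw [pow_succ', ← mul_assoc, abs_gamma1_mul_self (Nat.one_le_iff_ne_zero.1 (mem_Icc.1 hj).1),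
    mul_assoc]

theorem sum_abs_gamma1_mul_pow_le_of_eight_le {m : ℕ} (hm : 8 ≤ m) :
    ∑ j ∈ Icc 1 m, |gamma1 m j| * (j : ℝ) ^ (2 * m + 1) ≤
      π * m * ((m : ℝ) ^ (2 * m) * LamStar ^ m) := by
  have hL := LamStar_pos
  have below : ∑ j ∈ Ico 1 m, ((2 * m).choose (m + j) : ℝ) / ((2 * m).choose m : ℝ) *
      (j : ℝ) ^ (2 * m) ≤ (m : ℝ) ^ (2 * m) * LamStar ^ m * (m * (π / 2) - 1) := by
    refine (sum_le_sum fun j hj => choose_add_div_choose_mul_pow_le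
      (Nat.one_le_iff_ne_zero.1 (mem_Ico.1 hj).1) (mem_Ico.1 hj).2).trans ?_
    rw [← mul_sum]
    gcongr
    exact sum_one_div_sqrt_one_sub_sq_le (by lia)
  have top : ((2 * m).choose (m + m) : ℝ) / ((2 * m).choose m : ℝ) * (m : ℝ) ^ (2 * m) ≤
      (m : ℝ) ^ (2 * m) * LamStar ^ m := by
    rw [← two_mul, Nat.choose_self, ← Nat.centralBinom_eq_two_mul_choose, Nat.cast_one, mul_comm]
    gcongr
    rw [div_le_iff₀' (by exact_mod_cast m.centralBinom_pos)]
    exact one_le_centralBinom_mul_LamStar_pow hm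
  rw [sum_abs_gamma1_mul_pow_eq, ← Ico_insert_right (by lia : 1 ≤ m), sum_insert (by simp)]
  linarith

theorem sum_abs_gamma1_mul_pow_le {m : ℕ} (hm : 2 ≤ m) :
    ∑ j ∈ Icc 1 m, |gamma1 m j| * (j : ℝ) ^ (2 * m + 1) ≤
      π * m * ((m : ℝ) ^ (2 * m) * LamStar ^ m) := by
  rcases le_or_gt 8 m with h | h
  · exact sum_abs_gamma1_mul_pow_le_of_eight_le h
  have numeric : (3 : ℝ) * m * ((m : ℝ) ^ (2 * m) * 0.30812 ^ m) ≤
      π * m * ((m : ℝ) ^ (2 * m) * LamStar ^ m) := by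
    gcongr
    exacts [pi_gt_three.le, LamStar_gt_d5.le]
  refine le_trans ?_ numeric
  rw [sum_abs_gamma1_mul_pow_eq]
  interval_cases m <;> simp only [Finset.sum_Icc_succ_top, Nat.reduceLeDiff] <;>
    norm_num [Nat.choose]

theorem sum_abs_gamma1_mul_pow_one_le :
    ∑ j ∈ Icc 1 1, |gamma1 1 j| * (j : ℝ) ^ (2 * 1 + 1) ≤
      1.0331 * (π * (1 : ℕ) * (((1 : ℕ) : ℝ) ^ (2 * 1) * LamStar ^ 1)) := by
  have numeric : (1.0331 : ℝ) * (3.141592 * 0.30812) ≤ 1.0331 * (π * LamStar) := by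
    gcongr
    exacts [pi_gt_d6.le, LamStar_gt_d5.le]
  rw [sum_abs_gamma1_mul_pow_eq]
  norm_num [Nat.choose] at numeric ⊢
  linarith

/-! ### The explicit bound on the remainder -/

theorem one_add_sum_le_prod_add_one {ι : Type*} (s : Finset ι) (α : ι → ℕ) :
    1 + ∑ r ∈ s, α r ≤ ∏ r ∈ s, (α r + 1) := by
  classical
  induction s using Finset.induction_on with
  | empty => simp
  | insert a s ha ih =>
    rw [sum_insert ha, prod_insert ha]
    nlinarith [Nat.zero_le (α a * ∑ r ∈ s, α r)]

theorem mem_multiIndices {p d : ℕ} {α : Fin p → ℕ} : α ∈ multiIndices p d ↔ ∑ r, α r = d := by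
  simp [multiIndices]

theorem one_div_prod_factorial_succ_le {p d : ℕ} {α : Fin p → ℕ} (hα : α ∈ multiIndices p d) :
    1 / ∏ r, ((α r + 1).factorial : ℝ) ≤ Nat.multinomial univ α / (d + 1).factorial := by
  have multinomial_eq := Nat.multinomial_spec univ α
  have succ_le := one_add_sum_le_prod_add_one univ α
  rw [mem_multiIndices.1 hα] at multinomial_eq succ_le
  rw [div_le_div_iff₀ (prod_pos fun r _ => by positivity) (by positivity), one_mul]
  have factorial_le :
      (d + 1).factorial ≤ Nat.multinomial univ α * ∏ r, (α r + 1).factorial := calc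
    _ = (1 + d) * ((∏ r, (α r).factorial) * Nat.multinomial univ α) := by
        rw [multinomial_eq, Nat.factorial_succ, add_comm]
    _ ≤ (∏ r, (α r + 1)) * ((∏ r, (α r).factorial) * Nat.multinomial univ α) := by gcongr
    _ = Nat.multinomial univ α * ∏ r, (α r + 1).factorial := by
        simp only [Nat.factorial_succ, prod_mul_distrib]; ring
  exact_mod_cast factorial_le

theorem sum_multiIndices_prod_pow_div_factorial_le {p d : ℕ} {x : Fin p → ℝ} (hx : 0 ≤ x) :
    ∑ α ∈ multiIndices p d, 1 / (∏ r, ((α r + 1).factorial : ℝ)) * ∏ r, x r ^ α r ≤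
      (∑ r, x r) ^ d / (d + 1).factorial := by
  rw [sum_pow_eq_sum_piAntidiag, sum_div]
  refine sum_le_sum fun α hα => ?_
  rw [mul_div_right_comm]
  exact mul_le_mul_of_nonneg_right (one_div_prod_factorial_succ_le hα)
    (prod_nonneg fun r _ => pow_nonneg (hx r) _)

theorem sum_piFinset_prod_mul_apply {ι κ R : Type*} [Fintype ι] [DecidableEq ι] [CommSemiring R]
    (s : Finset κ) (w g : κ → R) (r : ι) :
    ∑ j ∈ Fintype.piFinset (fun _ : ι => s), (∏ q, w (j q)) * g (j r) =
      (∑ j ∈ s, w j) ^ (Fintype.card ι - 1) * ∑ j ∈ s, w j * g j := by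
  have absorb (j : ι → κ) : (∏ q, w (j q)) * g (j r) =
      ∏ q, w (j q) * if q = r then g (j q) else 1 := by
    rw [prod_mul_distrib, prod_ite_eq' univ r, if_pos (mem_univ r)]
  have away : ∀ q ∈ univ.erase r, (∑ j ∈ s, w j * if q = r then g j else 1) = ∑ j ∈ s, w j :=
    fun q hq => by simp only [if_neg (ne_of_mem_erase hq), mul_one]
  simp only [absorb]
  rw [← prod_univ_sum (fun _ => s) fun q j => w j * if q = r then g j else 1,
    ← prod_erase_mul univ _ (mem_univ r), prod_congr rfl away, prod_const,
    card_erase_of_mem (mem_univ r), card_univ]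
  simp only [if_true]

theorem remainderBound_eq (p m : ℕ) (M : ℝ) :
    remainderBound p m M = M / 2 ^ (2 * m) * ∑ j ∈ Icc (1 : Fin p → ℕ) (fun _ => m),
      (∏ r, |gamma1 m (j r)| * j r) * ∑ α ∈ multiIndices p (2 * m),
        1 / (∏ r, ((α r + 1).factorial : ℝ)) * ∏ r, (j r : ℝ) ^ α r := by
  rw [remainderBound]
  simp only [mul_sum]
  rw [sum_comm]
  refine sum_congr rfl fun j _ => sum_congr rfl fun α _ => ?_
  simp only [gammaCoeff, abs_prod, pow_succ, prod_mul_distrib]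
  ring

theorem rpow_add_one_div_two {x : ℝ} (hx : 0 ≤ x) {p : ℕ} (hp : p ≠ 0) :
    x ^ (((p : ℝ) + 1) / 2) = √x ^ (p - 1) * x := by
  calc x ^ (((p : ℝ) + 1) / 2) = √x ^ (p - 1 + 2) := by
        rw [show p - 1 + 2 = p + 1 by lia, sqrt_eq_rpow, ← rpow_mul_natCast hx]
        push_cast
        ring_nf
    _ = √x ^ (p - 1) * x := by rw [pow_add, sq_sqrt hx]

theorem kappa_pow_two_mul (m : ℕ) : kappa ^ (2 * m) = LamStar ^ m / 2 ^ (2 * m) := by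
  rw [kappa, pow_mul, sq_sqrt (div_nonneg LamStar_pos.le (by norm_num)), div_pow, pow_mul]
  norm_num

theorem sum_multiIndices_prod_pow_div_factorial_le_sum_pow {p d : ℕ} (hd : d ≠ 0)
    {x : Fin p → ℝ} (hx : 0 ≤ x) :
    ∑ α ∈ multiIndices p d, 1 / (∏ r, ((α r + 1).factorial : ℝ)) * ∏ r, x r ^ α r ≤
      (p : ℝ) ^ (d - 1) * (∑ r, x r ^ d) / (d + 1).factorial := by
  have power_mean := pow_sum_le_card_mul_sum_pow (s := univ) (f := x) (fun r _ => hx r) (d - 1)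
  rw [Nat.sub_add_cancel (by lia), card_univ, Fintype.card_fin] at power_mean
  exact (sum_multiIndices_prod_pow_div_factorial_le hx).trans (by gcongr)

theorem remainderBound_le_of_sum_abs_gamma1_le {p m : ℕ} {c M : ℝ} (hp : p ≠ 0) (hm : m ≠ 0)
    (hM : 0 ≤ M)
    (hc : ∑ j ∈ Icc 1 m, |gamma1 m j| * (j : ℝ) ^ (2 * m + 1) ≤
      c * (π * m * ((m : ℝ) ^ (2 * m) * LamStar ^ m))) :
    remainderBound p m M ≤ simpleBound c p m M := by
  set w : ℕ → ℝ := fun j => |gamma1 m j| * j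
  have (j : ℕ) : 0 ≤ w j := by positivity
  have separate : ∑ j ∈ Icc (1 : Fin p → ℕ) (fun _ => m), (∏ r, w (j r)) *
      ∑ r, (j r : ℝ) ^ (2 * m) =
        p * ((∑ j ∈ Icc 1 m, w j) ^ (p - 1) * ∑ j ∈ Icc 1 m, w j * (j : ℝ) ^ (2 * m)) := by
    simp only [mul_sum _ (fun _ => (_ : ℝ) ^ (2 * m)) (∏ _r, w _)]
    rw [sum_comm, Pi.Icc_eq]
    simp only [Pi.one_apply,
      sum_piFinset_prod_mul_apply (Icc 1 m) w (fun j => (j : ℝ) ^ (2 * m)), sum_const, card_univ,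
      Fintype.card_fin, nsmul_eq_mul]
  have hc' : ∑ j ∈ Icc 1 m, w j * (j : ℝ) ^ (2 * m) ≤
      c * (π * m * ((m : ℝ) ^ (2 * m) * LamStar ^ m)) := by
    simpa only [w, mul_assoc, ← pow_succ'] using hc
  rw [remainderBound_eq, simpleBound, rpow_add_one_div_two (by positivity) hp, mul_pow, mul_pow,
    kappa_pow_two_mul]
  calc _ ≤ M / 2 ^ (2 * m) * ∑ j ∈ Icc (1 : Fin p → ℕ) (fun _ => m), (∏ r, w (j r)) *
        ((p : ℝ) ^ (2 * m - 1) * (∑ r, (j r : ℝ) ^ (2 * m)) / (2 * m + 1).factorial) := by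
        gcongr with j
        exact sum_multiIndices_prod_pow_div_factorial_le_sum_pow (by lia) fun r =>
          Nat.cast_nonneg (j r)
    _ = M / 2 ^ (2 * m) * ((p : ℝ) ^ (2 * m - 1) / (2 * m + 1).factorial * (p *
        ((∑ j ∈ Icc 1 m, w j) ^ (p - 1) * ∑ j ∈ Icc 1 m, w j * (j : ℝ) ^ (2 * m)))) := by
        rw [← separate, mul_sum _ _ ((p : ℝ) ^ (2 * m - 1) / _)]
        congr 1
        exact sum_congr rfl fun j _ => by ring
    _ ≤ M / 2 ^ (2 * m) * ((p : ℝ) ^ (2 * m - 1) / (2 * m + 1).factorial * (p *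
        (√(π * m) ^ (p - 1) * (c * (π * m * ((m : ℝ) ^ (2 * m) * LamStar ^ m)))))) := by
        have := sum_abs_gamma1_mul_self_le hm
        gcongr
    _ = _ := by
        rw [← mul_pow_sub_one (by lia : 2 * m ≠ 0) (p : ℝ)]
        ring

theorem remainderBound_le_simpleBound {p m : ℕ} {M : ℝ} (hp : p ≠ 0) (hm : m ≠ 0) (hM : 0 ≤ M) :
    remainderBound p m M ≤ simpleBound 1.0331 p m M ∧
      (2 ≤ m → remainderBound p m M ≤ simpleBound 1.001 p m M) := by
  have hL := LamStar_pos
  have of_one_le {c : ℝ} (hc : 1 ≤ c) (h : 2 ≤ m) :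
      remainderBound p m M ≤ simpleBound c p m M :=
    remainderBound_le_of_sum_abs_gamma1_le hp hm hM
      ((sum_abs_gamma1_mul_pow_le h).trans (le_mul_of_one_le_left (by positivity) hc))
  refine ⟨?_, of_one_le (by norm_num)⟩
  obtain rfl | h : m = 1 ∨ 2 ≤ m := by lia
  · exact remainderBound_le_of_sum_abs_gamma1_le hp hm hM sum_abs_gamma1_mul_pow_one_le
  · exact of_one_le (by norm_num) h

/-! ### Tensor products of weighted point sums -/

section Tensor

variable {ι κ κ' X R : Type*} [Fintype ι] [DecidableEq ι] [CommSemiring R]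

theorem sum_piFinset_prod_mul_comp_eq [DecidableEq X] (A : ι → Finset κ) (a : ι → κ → R)
    (x : ι → κ → X) (Z : ι → Finset X) (hZ : ∀ r, ∀ i ∈ A r, x r i ∈ Z r) (F : (ι → X) → R) :
    ∑ i ∈ Fintype.piFinset A, (∏ r, a r (i r)) * F (fun r => x r (i r)) =
      ∑ z ∈ Fintype.piFinset Z,
        (∏ r, ∑ i ∈ A r, a r i * if x r i = z r then 1 else 0) * F z := by
  have expand : ∀ i ∈ Fintype.piFinset A, (∏ r, a r (i r)) * F (fun r => x r (i r)) =
      ∑ z ∈ Fintype.piFinset Z, (∏ r, a r (i r) * if x r (i r) = z r then 1 else 0) * F z := by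
    intro i hi
    have hx : (fun r => x r (i r)) ∈ Fintype.piFinset Z :=
      Fintype.mem_piFinset.2 fun r => hZ r _ (Fintype.mem_piFinset.1 hi r)
    rw [sum_eq_single_of_mem _ hx]
    · simp only [if_true, mul_one]
    · intro z _ hz
      obtain ⟨r, hr⟩ := Function.ne_iff.1 hz
      rw [prod_eq_zero (mem_univ r) (by rw [if_neg (Ne.symm hr), mul_zero]), zero_mul]
  rw [sum_congr rfl expand, sum_comm]
  exact sum_congr rfl fun z _ => by rw [← sum_mul, prod_univ_sum]

theorem sum_piFinset_prod_mul_comp_congr (A : ι → Finset κ) (a : ι → κ → R) (x : ι → κ → X)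
    (B : ι → Finset κ') (b : ι → κ' → R) (y : ι → κ' → X)
    (h : ∀ r (φ : X → R), ∑ i ∈ A r, a r i * φ (x r i) = ∑ k ∈ B r, b r k * φ (y r k))
    (F : (ι → X) → R) :
    ∑ i ∈ Fintype.piFinset A, (∏ r, a r (i r)) * F (fun r => x r (i r)) =
      ∑ k ∈ Fintype.piFinset B, (∏ r, b r (k r)) * F (fun r => y r (k r)) := by
  classical
  let Z : ι → Finset X := fun r => (A r).image (x r) ∪ (B r).image (y r)
  rw [sum_piFinset_prod_mul_comp_eq A a x Z
      fun r i hi => mem_union_left _ (mem_image_of_mem _ hi),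
    sum_piFinset_prod_mul_comp_eq B b y Z
      fun r k hk => mem_union_right _ (mem_image_of_mem _ hk)]
  refine sum_congr rfl fun z _ => ?_
  rw [prod_congr rfl fun r _ => h r fun t => if t = z r then 1 else 0]

theorem sum_piFinset_sum_piFinset {M : Type*} [AddCommMonoid M] (A : ι → Finset κ)
    (B : ι → κ → Finset κ') (H : (ι → κ) → (ι → κ') → M) :
    ∑ j ∈ Fintype.piFinset A, ∑ i ∈ Fintype.piFinset (fun r => B r (j r)), H j i =
      ∑ q ∈ Fintype.piFinset (fun r => (A r).sigma (B r)),
        H (fun r => (q r).1) (fun r => (q r).2) := by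
  rw [sum_sigma']
  refine sum_bij' (fun q _ r => ⟨q.1 r, q.2 r⟩) (fun q _ => ⟨fun r => (q r).1, fun r => (q r).2⟩)
    ?_ ?_ (fun _ _ => rfl) (fun _ _ => rfl) (fun _ _ => rfl)
  · exact fun q hq => Fintype.mem_piFinset.2 fun r => mem_sigma.2
      ⟨Fintype.mem_piFinset.1 (mem_sigma.1 hq).1 r, Fintype.mem_piFinset.1 (mem_sigma.1 hq).2 r⟩
  · exact fun q hq => mem_sigma.2
      ⟨Fintype.mem_piFinset.2 fun r => (mem_sigma.1 (Fintype.mem_piFinset.1 hq r)).1,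
        Fintype.mem_piFinset.2 fun r => (mem_sigma.1 (Fintype.mem_piFinset.1 hq r)).2⟩

end Tensor

/-! ### The functionals `A^J` -/

theorem AJ_eq_sum_sigma {p : ℕ} (l : ℕ) (F : (Fin p → ℝ) → ℝ) (J : Finset (Fin p))
    (n : Fin p → ℕ) :
    AJ l F J n = ∑ q ∈ Fintype.piFinset (fun _ : Fin p => (Icc 1 l).sigma range),
      (∏ r, gamma1 l (q r).1) *
        F (fun r => restrictTo J n r - 1 + ((q r).1 : ℝ) / 2 - ((q r).2 : ℝ)) := by
  rw [AJ, Pi.Icc_eq]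
  simp only [mul_sum, box, gammaCoeff]
  exact sum_piFinset_sum_piFinset (fun _ : Fin p => Icc 1 l) (fun _ => range) fun j i =>
    (∏ r, gamma1 l (j r)) * F (fun r => restrictTo J n r - 1 + (j r : ℝ) / 2 - (i r : ℝ))

-- The point indexed by `(j, i)` is `c - 1/2 - β/2` for `β = 2i + 1 - j`, and `j = 1 + |β| + 2b`.
theorem sum_gamma1_eq_sum_tau1 (l : ℕ) (c : ℝ) (φ : ℝ → ℝ) :
    ∑ q ∈ (Icc 1 l).sigma range, gamma1 l q.1 * φ (c - 1 + (q.1 : ℝ) / 2 - (q.2 : ℝ)) =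
      ∑ β ∈ Icc (1 - (l : ℤ)) ((l : ℤ) - 1),
        tau1 l (1 + β.natAbs) * φ (c - 1 / 2 - (β : ℝ) / 2) := by
  simp only [tau1, sum_mul]
  rw [sum_sigma']
  refine sum_bij'
    (fun q _ => ⟨2 * (q.2 : ℤ) + 1 - q.1, (q.1 - 1 - (2 * (q.2 : ℤ) + 1 - q.1).natAbs) / 2⟩)
    (fun q _ => ⟨1 + q.1.natAbs + 2 * q.2, ((q.1 + q.1.natAbs + 2 * q.2) / 2).toNat⟩)
    ?_ ?_ ?_ ?_ ?_
  · rintro ⟨j, i⟩ h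
    simp only [mem_sigma, mem_Icc, mem_range] at h ⊢
    lia
  · rintro ⟨β, b⟩ h
    simp only [mem_sigma, mem_Icc, mem_range] at h ⊢
    lia
  · rintro ⟨j, i⟩ h
    simp only [mem_sigma, mem_Icc, mem_range, Sigma.mk.injEq, heq_eq_eq] at h ⊢
    lia
  · rintro ⟨β, b⟩ h
    simp only [mem_sigma, mem_Icc, mem_range, Sigma.mk.injEq, heq_eq_eq] at h ⊢
    lia
  · rintro ⟨j, i⟩ h
    simp only [mem_sigma, mem_Icc, mem_range] at h
    have order_eq : 1 + (2 * (i : ℤ) + 1 - j).natAbs +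
        2 * ((j - 1 - (2 * (i : ℤ) + 1 - j).natAbs) / 2) = j := by lia
    have point_eq :
        c - 1 / 2 - ((2 * (i : ℤ) + 1 - j : ℤ) : ℝ) / 2 = c - 1 + (j : ℝ) / 2 - i := by
      push_cast; ring
    simp only [order_eq, point_eq]

theorem AJ_eq_sum_tau {p : ℕ} (l : ℕ) (F : (Fin p → ℝ) → ℝ) (J : Finset (Fin p))
    (n : Fin p → ℕ) :
    AJ l F J n = ∑ β ∈ Icc (fun _ : Fin p => 1 - (l : ℤ)) (fun _ => (l : ℤ) - 1),
      tauCoeff l (fun r => 1 + (β r).natAbs) *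
        F (fun r => restrictTo J n r - 1 / 2 - (β r : ℝ) / 2) := by
  rw [AJ_eq_sum_sigma, Pi.Icc_eq]
  exact sum_piFinset_prod_mul_comp_congr (fun _ => (Icc 1 l).sigma range)
    (fun _ q => gamma1 l q.1) (fun r q => restrictTo J n r - 1 + (q.1 : ℝ) / 2 - (q.2 : ℝ))
    (fun _ => Icc (1 - (l : ℤ)) (l - 1)) (fun _ β => tau1 l (1 + β.natAbs))
    (fun r β => restrictTo J n r - 1 / 2 - (β : ℝ) / 2)
    (fun r φ => sum_gamma1_eq_sum_tau1 l (restrictTo J n r) φ) F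

theorem mem_absFiber {p : ℕ} {α : Fin p → ℕ} {β : Fin p → ℤ} :
    β ∈ absFiber α ↔ ∀ r, (β r).natAbs = α r := by
  simp only [absFiber, mem_filter, mem_Icc, Pi.le_def, and_iff_right_iff_imp]
  intro h
  constructor <;> intro r <;> have := h r <;> lia

theorem sum_natAbs_mul_eq_sum_absFiber {p l : ℕ} (hl : l ≠ 0) (w : (Fin p → ℕ) → ℝ)
    (G : (Fin p → ℤ) → ℝ) :
    ∑ β ∈ Icc (fun _ : Fin p => 1 - (l : ℤ)) (fun _ => (l : ℤ) - 1),
      w (fun r => (β r).natAbs) * G β =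
    ∑ α ∈ Icc (0 : Fin p → ℕ) (fun _ => l - 1), w α * ∑ β ∈ absFiber α, G β := by
  have maps_to : ∀ β ∈ Icc (fun _ : Fin p => 1 - (l : ℤ)) (fun _ => (l : ℤ) - 1),
      (fun r => (β r).natAbs) ∈ Icc (0 : Fin p → ℕ) (fun _ => l - 1) := by
    simp only [mem_Icc, Pi.le_def, Pi.zero_apply]
    exact fun β hβ => ⟨fun r => Nat.zero_le _, fun r => by have := hβ.1 r; have := hβ.2 r; lia⟩
  rw [← sum_fiberwise_of_maps_to maps_to]
  refine sum_congr rfl fun α hα => ?_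
  have fiber_eq : (Icc (fun _ : Fin p => 1 - (l : ℤ)) (fun _ => (l : ℤ) - 1)).filter
      (fun β => (fun r => (β r).natAbs) = α) = absFiber α := by
    ext β
    simp only [mem_filter, mem_absFiber, mem_Icc, Pi.le_def, funext_iff,
      and_iff_right_iff_imp] at hα ⊢
    intro h
    constructor <;> intro r <;> have := h r <;> have := hα.2 r <;> lia
  rw [fiber_eq, mul_sum]
  exact sum_congr rfl fun β hβ => by rw [funext (mem_absFiber.1 hβ)]

theorem AJ_eq_sum_absFiber {p l : ℕ} (hl : l ≠ 0) (F : (Fin p → ℝ) → ℝ) (J : Finset (Fin p))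
    (n : Fin p → ℕ) :
    AJ l F J n = ∑ α ∈ Icc (0 : Fin p → ℕ) (fun _ => l - 1), tauCoeff l (fun r => 1 + α r) *
      ∑ β ∈ absFiber α, F (fun r => restrictTo J n r - 1 / 2 - (β r : ℝ) / 2) := by
  rw [AJ_eq_sum_tau]
  exact sum_natAbs_mul_eq_sum_absFiber hl (fun α => tauCoeff l (fun r => 1 + α r)) _

theorem restrictTo_empty {p : ℕ} (n : Fin p → ℕ) : restrictTo ∅ n = 0 := by
  ext r; simp [restrictTo]

theorem restrictTo_zero {p : ℕ} (J : Finset (Fin p)) : restrictTo J 0 = 0 := by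
  ext r; simp [restrictTo]

theorem AJ_empty_eq_AJ_empty_zero {p : ℕ} (l : ℕ) (F : (Fin p → ℝ) → ℝ) (n : Fin p → ℕ) :
    AJ l F ∅ n = AJ l F ∅ 0 := by
  simp only [AJ, restrictTo_empty]

theorem AJ_zero_eq_AJ_empty_zero {p : ℕ} (l : ℕ) (F : (Fin p → ℝ) → ℝ) (J : Finset (Fin p)) :
    AJ l F J 0 = AJ l F ∅ 0 := by
  simp only [AJ, restrictTo_zero]

theorem AJ_empty_zero_eq_sum_absFiber {p l : ℕ} (hl : l ≠ 0) (F : (Fin p → ℝ) → ℝ) :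
    AJ l F ∅ 0 = ∑ α ∈ Icc (0 : Fin p → ℕ) (fun _ => l - 1), tauCoeff l (fun r => 1 + α r) *
      ∑ β ∈ absFiber α, F (fun r => (β r : ℝ) / 2 - 1 / 2) := by
  rw [AJ_eq_sum_absFiber hl]
  refine sum_congr rfl fun α _ => congrArg _ ?_
  have neg_mem (β : Fin p → ℤ) (hβ : β ∈ absFiber α) : -β ∈ absFiber α := by
    rw [mem_absFiber] at hβ ⊢
    simpa using hβ
  refine sum_bij' (fun β _ => -β) (fun β _ => -β) neg_mem neg_mem (fun β _ => neg_neg β)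
    (fun β _ => neg_neg β) fun β _ => congrArg F (funext fun r => ?_)
  rw [restrictTo_zero, Pi.zero_apply, Pi.neg_apply, Int.cast_neg]
  ring

/-! ### Telescoping -/

theorem sum_range_sub_half (j n : ℕ) (φ : ℝ → ℝ) :
    ∑ k ∈ range n, (φ (k + (j : ℝ) / 2) - φ (k - (j : ℝ) / 2)) =
      ∑ i ∈ range j, (φ (n - 1 + (j : ℝ) / 2 - i) - φ (0 - 1 + (j : ℝ) / 2 - i)) := by
  induction n with
  | zero => simp
  | succ n ih =>
    have telescope : φ (n + (j : ℝ) / 2) - φ (n - (j : ℝ) / 2) =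
        ∑ i ∈ range j, (φ (n + (j : ℝ) / 2 - i) - φ (n - 1 + (j : ℝ) / 2 - i)) := by
      have := sum_range_sub' (fun i : ℕ => φ (n + (j : ℝ) / 2 - i)) j
      rw [Nat.cast_zero, sub_zero,
        show (n : ℝ) + (j : ℝ) / 2 - j = n - (j : ℝ) / 2 by ring] at this
      rw [← this]
      refine sum_congr rfl fun i _ => ?_
      rw [show (n : ℝ) + (j : ℝ) / 2 - (i + 1 : ℕ) = n - 1 + (j : ℝ) / 2 - i by push_cast; ring]
    rw [sum_range_succ, ih, telescope, ← sum_add_distrib]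
    refine sum_congr rfl fun i _ => ?_
    rw [show ((n + 1 : ℕ) : ℝ) - 1 + (j : ℝ) / 2 - i = n + (j : ℝ) / 2 - i by push_cast; ring]
    ring

theorem sum_finset_neg_one_pow_mul_eq_sum_bool {p : ℕ} (H : (Fin p → Bool) → ℝ) :
    ∑ J : Finset (Fin p), (-1 : ℝ) ^ (p - #J) * H (fun r => decide (r ∈ J)) =
      ∑ ε ∈ Fintype.piFinset (fun _ : Fin p => (univ : Finset Bool)),
        (∏ r, if ε r then (1 : ℝ) else -1) * H ε := by
  refine sum_bij' (fun J _ r => decide (r ∈ J)) (fun ε _ => univ.filter fun r => ε r = true)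
    (fun _ _ => Fintype.mem_piFinset.2 fun _ => mem_univ _) (fun _ _ => mem_univ _)
    (fun J _ => by ext; simp) (fun ε _ => by ext; simp) fun J _ => congrArg (· * _) ?_
  simp only [decide_eq_true_eq]
  rw [prod_ite, prod_const_one, one_mul, prod_const, filter_not, filter_mem_eq_inter, univ_inter,
    ← compl_eq_univ_sdiff, card_compl, Fintype.card_fin]

theorem sum_finset_neg_one_pow_mul_sum_box {p : ℕ} (n : Fin p → ℕ) (x : Fin p → Bool → ℕ → ℝ)
    (F : (Fin p → ℝ) → ℝ) :
    ∑ J : Finset (Fin p), (-1 : ℝ) ^ (p - #J) *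
      ∑ k ∈ box n, F (fun r => x r (decide (r ∈ J)) (k r)) =
    ∑ q ∈ Fintype.piFinset (fun r => (univ : Finset Bool).sigma fun _ => range (n r)),
      (∏ r, if (q r).1 then (1 : ℝ) else -1) * F (fun r => x r (q r).1 (q r).2) := by
  rw [sum_finset_neg_one_pow_mul_eq_sum_bool fun ε => ∑ k ∈ box n, F (fun r => x r (ε r) (k r))]
  simp only [mul_sum, box]
  exact sum_piFinset_sum_piFinset (fun _ => univ) (fun r _ => range (n r)) fun ε k =>
    (∏ r, if ε r then (1 : ℝ) else -1) * F (fun r => x r (ε r) (k r))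

theorem sum_finset_neg_one_pow_mul_sum_box_swap {p : ℕ} (F : (Fin p → ℝ) → ℝ)
    (j n : Fin p → ℕ) :
    ∑ J : Finset (Fin p), (-1 : ℝ) ^ (p - #J) * ∑ k ∈ box n,
      F (fun r => k r + if r ∈ J then (j r : ℝ) / 2 else -((j r : ℝ) / 2)) =
    ∑ J : Finset (Fin p), (-1 : ℝ) ^ (p - #J) * ∑ i ∈ box j,
      F (fun r => restrictTo J n r - 1 + (j r : ℝ) / 2 - i r) := by
  have center_tensor := sum_finset_neg_one_pow_mul_sum_box n
    (fun r ε k => k + if ε then (j r : ℝ) / 2 else -((j r : ℝ) / 2)) F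
  have boundary_tensor := sum_finset_neg_one_pow_mul_sum_box j
    (fun r ε i => (if ε then (n r : ℝ) else 0) - 1 + (j r : ℝ) / 2 - i) F
  simp only [decide_eq_true_eq] at center_tensor boundary_tensor
  simp only [restrictTo]
  rw [center_tensor, boundary_tensor]
  refine sum_piFinset_prod_mul_comp_congr _
    (fun _ (q : Σ _ : Bool, ℕ) => if q.1 then (1 : ℝ) else -1)
    (fun r q => q.2 + if q.1 then (j r : ℝ) / 2 else -((j r : ℝ) / 2)) _
    (fun _ (q : Σ _ : Bool, ℕ) => if q.1 then (1 : ℝ) else -1)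
    (fun r q => (if q.1 then (n r : ℝ) else 0) - 1 + (j r : ℝ) / 2 - q.2) (fun r φ => ?_) F
  have swap := sum_range_sub_half (j r) (n r) φ
  rw [sum_sub_distrib, sum_sub_distrib] at swap
  simpa only [sum_sigma, Fintype.sum_bool, if_true, Bool.false_eq_true, if_false, one_mul,
    neg_mul, sum_neg_distrib, ← sub_eq_add_neg] using swap

/-! ### Moments of the coefficients `γ_{l,j}` -/

theorem gamma1_mul_self {l j : ℕ} (hj : j ≠ 0) :
    gamma1 l j * j =
      -(2 * (-1) ^ j * (((2 * l).choose (l + j) : ℝ) / ((2 * l).choose l : ℝ))) := by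
  obtain ⟨i, rfl⟩ := Nat.exists_eq_succ_of_ne_zero hj
  rw [gamma1, Nat.succ_sub_one, pow_succ]
  field_simp

theorem sum_range_neg_one_pow_mul_choose_mul_sub_pow {l a : ℕ} (ha : a < 2 * l) :
    ∑ k ∈ range (2 * l + 1), (-1 : ℝ) ^ k * (2 * l).choose k * ((k : ℝ) - l) ^ a = 0 := by
  have := congrFun (fwdDiff_iter_pow_eq_zero_of_lt (R := ℝ) ha) (-(l : ℝ))
  rw [fwdDiff_iter_eq_sum_shift, Pi.zero_apply] at this
  rw [← this]
  refine sum_congr rfl fun k hk => ?_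
  have parity : (-1 : ℝ) ^ (2 * l - k) = (-1) ^ k := by
    have : 2 * l - k + 2 * k = 2 * l + k := by have := mem_range.1 hk; lia
    simpa [pow_add, pow_mul] using congrArg (fun e => (-1 : ℝ) ^ e) this
  rw [zsmul_eq_mul, nsmul_eq_mul, mul_one, neg_add_eq_sub]
  push_cast
  rw [parity]

theorem sum_gamma1_mul_pow {l a : ℕ} (ha : Even a) (hal : a < 2 * l) :
    ∑ j ∈ Icc 1 l, gamma1 l j * (j : ℝ) ^ (a + 1) = if a = 0 then 1 else 0 := by
  have alternating := sum_range_neg_one_pow_mul_choose_mul_sub_pow hal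
  have pair : ∀ j ∈ Icc 1 l,
      (-1 : ℝ) ^ (l + j) * (2 * l).choose (l + j) * (((l + j : ℕ) : ℝ) - l) ^ a +
        (-1 : ℝ) ^ (l - j) * (2 * l).choose (l - j) * (((l - j : ℕ) : ℝ) - l) ^ a =
      -((-1) ^ l * (2 * l).choose l) * (gamma1 l j * (j : ℝ) ^ (a + 1)) := by
    intro j hj
    obtain ⟨one_le, le_l⟩ := mem_Icc.1 hj
    have choose_ne : ((2 * l).choose l : ℝ) ≠ 0 := by exact_mod_cast Nat.centralBinom_ne_zero l
    have parity : (-1 : ℝ) ^ (l - j) = (-1) ^ (l + j) := by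
      rw [show l + j = l - j + 2 * j by lia, pow_add, pow_mul, neg_one_sq, one_pow, mul_one]
    rw [pow_succ', ← mul_assoc (gamma1 l j), gamma1_mul_self (by lia), parity,
      Nat.choose_symm_of_eq_add (by lia : 2 * l = l - j + (l + j)), Nat.cast_sub le_l,
      Nat.cast_add, add_sub_cancel_left, sub_sub_cancel_left, ha.neg_pow, pow_add]
    field_simp
    ring
  rw [sum_range_two_mul_add_one, sum_congr rfl pair, ← mul_sum, sub_self, neg_mul,
    ← sub_eq_add_neg, ← mul_sub] at alternating
  rw [← zero_pow_eq]
  refine (sub_eq_zero.1 <| (mul_eq_zero.1 alternating).resolve_left ?_).symm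
  exact mul_ne_zero (pow_ne_zero _ (by norm_num))
    (by exact_mod_cast Nat.centralBinom_ne_zero l)

theorem sum_gamma1_mul_pow_sub {l a : ℕ} (hal : a ≤ 2 * l) :
    ∑ j ∈ Icc 1 l, gamma1 l j * (((j : ℝ) / 2) ^ a - (-((j : ℝ) / 2)) ^ a) =
      if a = 1 then 1 else 0 := by
  rcases Nat.even_or_odd' a with ⟨b, rfl | rfl⟩
  · simp only [(even_two_mul b).neg_pow, sub_self, mul_zero, sum_const_zero,
      if_neg (by lia : 2 * b ≠ 1)]
  · have odd_term (j : ℕ) : gamma1 l j * (((j : ℝ) / 2) ^ (2 * b + 1) -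
        (-((j : ℝ) / 2)) ^ (2 * b + 1)) =
        (1 / 2 ^ (2 * b)) * (gamma1 l j * (j : ℝ) ^ (2 * b + 1)) := by
      rw [(odd_two_mul_add_one b).neg_pow, div_pow, pow_succ (2 : ℝ)]
      field_simp
      ring
    simp only [odd_term, ← mul_sum, sum_gamma1_mul_pow (even_two_mul b) (by lia : 2 * b < 2 * l)]
    rcases eq_or_ne b 0 with rfl | hb
    · simp
    · rw [if_neg (by lia), if_neg (by lia), mul_zero]

theorem sum_gamma1_mul_eval_sub {l : ℕ} (hl : l ≠ 0) {Q : Polynomial ℝ}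
    (hQ : Q.natDegree ≤ 2 * l) :
    ∑ j ∈ Icc 1 l, gamma1 l j * (Q.eval ((j : ℝ) / 2) - Q.eval (-((j : ℝ) / 2))) =
      Q.coeff 1 := by
  simp only [Polynomial.eval_eq_sum_range' (Nat.lt_succ_of_le hQ), ← sum_sub_distrib, ← mul_sub,
    mul_sum, mul_left_comm (gamma1 l _)]
  rw [sum_comm]
  have monomial : ∀ a ∈ range (2 * l).succ, ∑ j ∈ Icc 1 l,
      Q.coeff a * (gamma1 l j * (((j : ℝ) / 2) ^ a - (-((j : ℝ) / 2)) ^ a)) =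
      if a = 1 then Q.coeff a else 0 := fun a ha => by
    rw [← mul_sum, sum_gamma1_mul_pow_sub (Nat.lt_succ_iff.1 (mem_range.1 ha)), mul_ite, mul_one,
      mul_zero]
  rw [sum_congr rfl monomial, sum_ite_eq' _ 1, if_pos (mem_range.2 (by lia))]

theorem natDegree_bernoulli_le (n : ℕ) : (Polynomial.bernoulli n).natDegree ≤ n :=
  Polynomial.natDegree_le_iff_coeff_eq_zero.2 fun N hN => by
    rw [Polynomial.coeff_bernoulli, if_neg (by lia)]

open Polynomial in
theorem exists_natDegree_le_and_eval_sub_eq_pow (a : ℕ) :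
    ∃ Q : ℝ[X], Q.natDegree ≤ a + 1 ∧ ∀ x, Q.eval (x + 1 / 2) - Q.eval (x - 1 / 2) = x ^ a := by
  let B : ℝ[X] := (Polynomial.bernoulli (a + 1)).map (algebraMap ℚ ℝ)
  have B_succ (x : ℝ) : B.eval (1 + x) = B.eval x + (a + 1) * x ^ a := by
    simpa [B, eval_map_algebraMap, aeval_comp] using
      congrArg (aeval x) (bernoulli_comp_one_add_X (a + 1))
  refine ⟨C ((a + 1 : ℝ)⁻¹) * B.comp (X + C (1 / 2)), ?_, fun x => ?_⟩
  · refine (natDegree_C_mul_le _ _).trans ?_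
    rw [natDegree_comp, natDegree_X_add_C, mul_one]
    exact natDegree_map_le.trans (natDegree_bernoulli_le _)
  · simp only [eval_mul, eval_C, eval_comp, eval_add, eval_X]
    rw [show x + 1 / 2 + 1 / 2 = 1 + x by ring, sub_add_cancel, B_succ]
    field_simp
    ring

/-- The linear functional underlying `AJ`, with nodes `-1/2 + j/2 - i`, so that `A^J_{l,F}(n)` is
its value at the translate of `F` by `n 1_J - 1/2`. -/
noncomputable def gammaFunctional (p l : ℕ) : ((Fin p → ℝ) → ℝ) →L[ℝ] ℝ :=
  ∑ j ∈ Icc (1 : Fin p → ℕ) (fun _ => l), gammaCoeff l j •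
    ∑ i ∈ box j, ContinuousLinearMap.proj (fun r => -(1 / 2) + (j r : ℝ) / 2 - i r)

theorem gammaFunctional_apply {p : ℕ} (l : ℕ) (g : (Fin p → ℝ) → ℝ) :
    gammaFunctional p l g = ∑ j ∈ Icc (1 : Fin p → ℕ) (fun _ => l), gammaCoeff l j *
      ∑ i ∈ box j, g (fun r => -(1 / 2) + (j r : ℝ) / 2 - i r) := by
  simp [gammaFunctional]

/-- The `a`-th moment of the one-dimensional version of `gammaFunctional`. -/
noncomputable def gammaMoment (l a : ℕ) : ℝ :=
  ∑ j ∈ Icc 1 l, gamma1 l j * ∑ i ∈ range j, (-(1 / 2) + (j : ℝ) / 2 - i) ^ a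

theorem gammaMoment_eq_gammaMoment {l l' a : ℕ} (h : a < 2 * l) (h' : a < 2 * l') :
    gammaMoment l a = gammaMoment l' a := by
  obtain ⟨Q, hQ, Q_sub⟩ := exists_natDegree_le_and_eval_sub_eq_pow a
  suffices key : ∀ k, a < 2 * k → gammaMoment k a = Q.coeff 1 by rw [key l h, key l' h']
  intro k hk
  rw [gammaMoment, ← sum_gamma1_mul_eval_sub (by lia : k ≠ 0) (hQ.trans hk)]
  refine sum_congr rfl fun j _ => congrArg _ ?_
  have telescope := sum_range_sub' (fun i : ℕ => Q.eval ((j : ℝ) / 2 - i)) j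
  rw [Nat.cast_zero, sub_zero, show (j : ℝ) / 2 - j = -(j / 2) by ring] at telescope
  rw [← telescope]
  refine sum_congr rfl fun i _ => ?_
  rw [← Q_sub]
  congr 2 <;> push_cast <;> ring

theorem AJ_eq_gammaFunctional {p : ℕ} (l : ℕ) (F : (Fin p → ℝ) → ℝ) (J : Finset (Fin p))
    (n : Fin p → ℕ) :
    AJ l F J n = gammaFunctional p l fun w => F ((restrictTo J n - 1 / 2) + w) := by
  rw [gammaFunctional_apply, AJ]
  refine sum_congr rfl fun j _ => congrArg _ <| sum_congr rfl fun i _ => congrArg F ?_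
  ext r
  simp only [Pi.add_apply, Pi.sub_apply, Pi.div_apply, Pi.ofNat_apply]
  ring

theorem gammaFunctional_prod_pow {p : ℕ} (l : ℕ) (α : Fin p → ℕ) :
    gammaFunctional p l (fun w => ∏ r, w r ^ α r) = ∏ r, gammaMoment l (α r) := by
  rw [gammaFunctional_apply, Pi.Icc_eq]
  simp only [box, gammaCoeff, gammaMoment, prod_univ_sum, prod_mul_distrib, Pi.one_apply]

theorem gammaFunctional_prod_pow_eq {p l l' : ℕ} {α : Fin p → ℕ} (h : ∑ r, α r < 2 * l)
    (h' : ∑ r, α r < 2 * l') :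
    gammaFunctional p l (fun w => ∏ r, w r ^ α r) =
      gammaFunctional p l' (fun w => ∏ r, w r ^ α r) := by
  simp only [gammaFunctional_prod_pow]
  refine prod_congr rfl fun r _ => ?_
  have : α r ≤ ∑ q, α q := single_le_sum_of_canonicallyOrdered (mem_univ r)
  exact gammaMoment_eq_gammaMoment (this.trans_lt h) (this.trans_lt h')

/-! ### Partial derivatives and Taylor's formula -/

section Derivatives

variable {p : ℕ}

theorem partialDeriv_eq_fderiv {g : (Fin p → ℝ) → ℝ} (hg : Differentiable ℝ g) (r : Fin p) :
    partialDeriv r g = fun x => fderiv ℝ g x (Pi.single r 1) :=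
  funext fun x => (hg x).lineDeriv_eq_fderiv

theorem contDiff_partialDeriv {g : (Fin p → ℝ) → ℝ} {n : ℕ} (hg : ContDiff ℝ (n + 1 : ℕ) g)
    (r : Fin p) : ContDiff ℝ n (partialDeriv r g) := by
  rw [partialDeriv_eq_fderiv (hg.differentiable (by simp))]
  exact (hg.fderiv_right (m := n) (by norm_cast)).clm_apply contDiff_const

theorem partialDeriv_comm {g : (Fin p → ℝ) → ℝ} (hg : ContDiff ℝ (2 : ℕ) g) (r q : Fin p) :
    partialDeriv r (partialDeriv q g) = partialDeriv q (partialDeriv r g) := by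
  have differentiable_g : Differentiable ℝ g := hg.differentiable (by simp)
  have differentiable_fderiv : Differentiable ℝ (fderiv ℝ g) :=
    (hg.fderiv_right (m := (1 : ℕ)) (by norm_cast)).differentiable (by simp)
  have differentiable_partialDeriv (q : Fin p) : Differentiable ℝ (partialDeriv q g) :=
    (contDiff_partialDeriv (n := 1) hg q).differentiable (by simp)
  rw [partialDeriv_eq_fderiv (differentiable_partialDeriv q),
    partialDeriv_eq_fderiv (differentiable_partialDeriv r),
    partialDeriv_eq_fderiv differentiable_g, partialDeriv_eq_fderiv differentiable_g]
  ext x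
  rw [fderiv_clm_apply (differentiable_fderiv x) (by fun_prop),
    fderiv_clm_apply (differentiable_fderiv x) (by fun_prop)]
  have symm : IsSymmSndFDerivAt ℝ g x := hg.contDiffAt.isSymmSndFDerivAt (by simp)
  simpa using symm.eq (Pi.single r 1) (Pi.single q 1)

theorem contDiff_iterate_partialDeriv {g : (Fin p → ℝ) → ℝ} {n a : ℕ}
    (hg : ContDiff ℝ (n + a : ℕ) g) (r : Fin p) : ContDiff ℝ n ((partialDeriv r)^[a] g) := by
  induction a generalizing n with
  | zero => exact hg
  | succ a ih =>
    rw [Function.iterate_succ_apply']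
    exact contDiff_partialDeriv (ih (by rwa [add_right_comm])) r

theorem partialDeriv_iterate_comm {g : (Fin p → ℝ) → ℝ} {a : ℕ} (hg : ContDiff ℝ (a + 1 : ℕ) g)
    (r q : Fin p) :
    partialDeriv r ((partialDeriv q)^[a] g) = (partialDeriv q)^[a] (partialDeriv r g) := by
  induction a with
  | zero => rfl
  | succ a ih =>
    rw [Function.iterate_succ_apply', Function.iterate_succ_apply', partialDeriv_comm,
      ih (hg.of_le (by norm_cast; lia))]
    exact contDiff_iterate_partialDeriv (by rwa [show 2 + a = a + 1 + 1 by ring]) q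

/-- The factors of `multiDeriv α` for the coordinates in the list `L`; this form allows induction
on the coordinates. -/
noncomputable def multiDerivOn (L : List (Fin p)) (α : Fin p → ℕ) (g : (Fin p → ℝ) → ℝ) :
    (Fin p → ℝ) → ℝ :=
  L.foldr (fun r h => (partialDeriv r)^[α r] h) g

theorem contDiff_multiDerivOn {g : (Fin p → ℝ) → ℝ} {α : Fin p → ℕ} (L : List (Fin p)) {n : ℕ}
    (hg : ContDiff ℝ (n + (L.map α).sum : ℕ) g) : ContDiff ℝ n (multiDerivOn L α g) := by
  induction L generalizing n with
  | nil => simpa [multiDerivOn] using hg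
  | cons q L ih =>
    rw [List.map_cons, List.sum_cons, ← add_assoc] at hg
    exact contDiff_iterate_partialDeriv (ih hg) q

theorem partialDeriv_multiDerivOn {g : (Fin p → ℝ) → ℝ} {α : Fin p → ℕ} {L : List (Fin p)}
    (hL : L.Nodup) {r : Fin p} (hr : r ∈ L) (hg : ContDiff ℝ ((L.map α).sum + 1 : ℕ) g) :
    partialDeriv r (multiDerivOn L α g) = multiDerivOn L (α + Pi.single r 1) g := by
  induction L with
  | nil => exact absurd hr List.not_mem_nil
  | cons q L ih =>
    obtain ⟨hqL, hL⟩ := List.nodup_cons.1 hL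
    rw [List.map_cons, List.sum_cons] at hg
    change partialDeriv r ((partialDeriv q)^[α q] (multiDerivOn L α g)) =
      (partialDeriv q)^[(α + Pi.single r 1 : Fin p → ℕ) q] (multiDerivOn L (α + Pi.single r 1) g)
    rcases eq_or_ne r q with rfl | hrq
    · have unchanged : multiDerivOn L (α + Pi.single r 1) g = multiDerivOn L α g := by
        refine List.foldr_ext _ _ _ fun s hs h => ?_
        rw [Pi.add_apply, Pi.single_eq_of_ne (ne_of_mem_of_not_mem hs hqL), add_zero]
      rw [unchanged, Pi.add_apply, Pi.single_eq_same, Function.iterate_succ_apply']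
    · have hg' : ContDiff ℝ (α q + 1 + (L.map α).sum : ℕ) g := by rwa [add_right_comm]
      rw [partialDeriv_iterate_comm (contDiff_multiDerivOn L hg'),
        ih hL ((List.mem_cons.1 hr).resolve_left hrq) (hg.of_le (by norm_cast; lia)),
        Pi.add_apply, Pi.single_eq_of_ne hrq.symm, add_zero]

theorem sum_map_finRange (α : Fin p → ℕ) : ((List.finRange p).map α).sum = ∑ r, α r := by
  rw [← List.sum_ofFn, List.ofFn_eq_map]

theorem contDiff_multiDeriv {g : (Fin p → ℝ) → ℝ} {α : Fin p → ℕ} {n : ℕ}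
    (hg : ContDiff ℝ (n + ∑ r, α r : ℕ) g) : ContDiff ℝ n (multiDeriv α g) :=
  contDiff_multiDerivOn (List.finRange p) (by rwa [sum_map_finRange])

theorem continuous_multiDeriv {g : (Fin p → ℝ) → ℝ} {α : Fin p → ℕ}
    (hg : ContDiff ℝ (∑ r, α r : ℕ) g) : Continuous (multiDeriv α g) :=
  (contDiff_multiDeriv (n := 0) (by rwa [zero_add])).continuous

theorem partialDeriv_multiDeriv {g : (Fin p → ℝ) → ℝ} {α : Fin p → ℕ}
    (hg : ContDiff ℝ (∑ r, α r + 1 : ℕ) g) (r : Fin p) :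
    partialDeriv r (multiDeriv α g) = multiDeriv (α + Pi.single r 1) g :=
  partialDeriv_multiDerivOn (List.nodup_finRange p) (List.mem_finRange r)
    (by rwa [sum_map_finRange])

theorem multiDeriv_zero (g : (Fin p → ℝ) → ℝ) : multiDeriv 0 g = g :=
  List.foldr_fixed (List.finRange p)

theorem hasDerivAt_comp_add_smul {g : (Fin p → ℝ) → ℝ} (hg : Differentiable ℝ g)
    (x w : Fin p → ℝ) (s : ℝ) :
    HasDerivAt (fun s : ℝ => g (x + s • w)) (∑ r, w r * partialDeriv r g (x + s • w)) s := by
  have line : HasDerivAt (fun s : ℝ => x + s • w) w s := by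
    simpa using ((hasDerivAt_id s).smul_const w).const_add x
  refine ((hg (x + s • w)).hasFDerivAt.comp_hasDerivAt s line).congr_deriv ?_
  simp only [partialDeriv_eq_fderiv hg]
  generalize x + s • w = y
  conv_lhs => rw [pi_eq_sum_univ' w]
  simp only [map_sum, map_smul, smul_eq_mul]

end Derivatives

section Taylor

variable {p : ℕ}

theorem mul_prod_pow_div_factorial_add_single (w : Fin p → ℝ) (α : Fin p → ℕ) (r : Fin p) :
    ((α r : ℝ) + 1) * (∏ q, w q ^ (α + Pi.single r 1 : Fin p → ℕ) q /
        ((α + Pi.single r 1 : Fin p → ℕ) q).factorial) =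
      w r * ∏ q, w q ^ α q / (α q).factorial := by
  rw [← mul_prod_erase univ _ (mem_univ r), ← mul_prod_erase univ (fun q => _ / _) (mem_univ r)]
  have away : ∀ q ∈ univ.erase r, w q ^ (α + Pi.single r 1 : Fin p → ℕ) q /
      ((α + Pi.single r 1 : Fin p → ℕ) q).factorial = w q ^ α q / (α q).factorial := fun q hq => by
    rw [Pi.add_apply, Pi.single_eq_of_ne (ne_of_mem_erase hq), add_zero]
  rw [prod_congr rfl away, Pi.add_apply, Pi.single_eq_same, Nat.factorial_succ]
  push_cast
  field_simp
  ring

theorem sum_multiIndices_succ_mul_apply (k : ℕ) (r : Fin p) (H : (Fin p → ℕ) → ℝ) :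
    ∑ α ∈ multiIndices p k, ((α r : ℝ) + 1) * H (α + Pi.single r 1) =
      ∑ β ∈ multiIndices p (k + 1), (β r : ℝ) * H β := by
  refine sum_of_injOn (· + Pi.single r 1) (add_left_injective _).injOn ?_ ?_ ?_
  · intro α hα
    rw [mem_coe, mem_multiIndices] at hα ⊢
    simp [sum_add_distrib, hα]
  · intro β hβ not_mem
    by_contra ne_zero
    have pos : Pi.single r 1 ≤ β := update_le_iff.2
      ⟨Nat.one_le_iff_ne_zero.2 fun h => by simp [h] at ne_zero, fun _ _ => Nat.zero_le _⟩
    refine not_mem ⟨β - Pi.single r 1, ?_, tsub_add_cancel_of_le pos⟩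
    rw [← tsub_add_cancel_of_le pos, mem_multiIndices] at hβ
    simpa [mem_multiIndices, sum_add_distrib] using hβ
  · intro α _
    simp

theorem sum_multiIndices_mul_sum_add_single (k : ℕ) (w : Fin p → ℝ) (H : (Fin p → ℕ) → ℝ) :
    ∑ α ∈ multiIndices p k, (∏ q, w q ^ α q / (α q).factorial) *
        ∑ r, w r * H (α + Pi.single r 1) =
      (k + 1) * ∑ β ∈ multiIndices p (k + 1), (∏ q, w q ^ β q / (β q).factorial) * H β := by
  let H' : (Fin p → ℕ) → ℝ := fun β => (∏ q, w q ^ β q / (β q).factorial) * H β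
  calc ∑ α ∈ multiIndices p k, (∏ q, w q ^ α q / (α q).factorial) *
        ∑ r, w r * H (α + Pi.single r 1)
      = ∑ r, ∑ α ∈ multiIndices p k, ((α r : ℝ) + 1) * H' (α + Pi.single r 1) := by
        simp only [mul_sum]
        rw [sum_comm]
        refine sum_congr rfl fun r _ => sum_congr rfl fun α _ => ?_
        rw [← mul_assoc, ← mul_assoc, mul_prod_pow_div_factorial_add_single, mul_comm (w r)]
    _ = ∑ β ∈ multiIndices p (k + 1), (∑ r, (β r : ℝ)) * H' β := by
        simp only [sum_multiIndices_succ_mul_apply, sum_mul]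
        exact sum_comm
    _ = (k + 1) * ∑ β ∈ multiIndices p (k + 1), H' β := by
        rw [mul_sum]
        refine sum_congr rfl fun β hβ => ?_
        rw [← Nat.cast_sum, mem_multiIndices.1 hβ, Nat.cast_succ]

/-- The term of degree `k` in the Taylor expansion of `f (x + w)` in powers of `w`. -/
noncomputable def taylorTerm (k : ℕ) (f : (Fin p → ℝ) → ℝ) (x w : Fin p → ℝ) : ℝ :=
  ∑ α ∈ multiIndices p k, (∏ q, w q ^ α q / (α q).factorial) * multiDeriv α f x

theorem taylorTerm_zero (f : (Fin p → ℝ) → ℝ) (x w : Fin p → ℝ) : taylorTerm 0 f x w = f x := by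
  simp [taylorTerm, multiIndices, multiDeriv_zero]

theorem hasDerivAt_taylorTerm {f : (Fin p → ℝ) → ℝ} {k : ℕ} (hf : ContDiff ℝ (k + 1 : ℕ) f)
    (x w : Fin p → ℝ) (s : ℝ) :
    HasDerivAt (fun s : ℝ => taylorTerm k f (x + s • w) w)
      ((k + 1) * taylorTerm (k + 1) f (x + s • w) w) s := by
  have term : ∀ α ∈ multiIndices p k, HasDerivAt
      (fun s : ℝ => (∏ q, w q ^ α q / (α q).factorial) * multiDeriv α f (x + s • w))
      ((∏ q, w q ^ α q / (α q).factorial) *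
        ∑ r, w r * multiDeriv (α + Pi.single r 1) f (x + s • w)) s := by
    intro α hα
    rw [← mem_multiIndices.1 hα] at hf
    have : Differentiable ℝ (multiDeriv α f) :=
      (contDiff_multiDeriv (n := 1) (by rwa [add_comm 1])).differentiable (by simp)
    have line := hasDerivAt_comp_add_smul this x w s
    simp only [partialDeriv_multiDeriv hf] at line
    exact line.const_mul _
  exact (HasDerivAt.fun_sum term).congr_deriv
    (sum_multiIndices_mul_sum_add_single k w fun β => multiDeriv β f (x + s • w))

theorem iteratedFDeriv_apply_const_eq_taylorTerm {f : (Fin p → ℝ) → ℝ} {k : ℕ}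
    (hf : ContDiff ℝ k f) (x w : Fin p → ℝ) :
    iteratedFDeriv ℝ k f x (fun _ => w) = k.factorial * taylorTerm k f x w := by
  induction k generalizing x with
  | zero => simp [taylorTerm_zero]
  | succ k ih =>
    have deriv_line := ContDiffAt.deriv_fderiv_add_smul (𝕜 := ℝ) (n := k) (f := f) (x := x)
      (y := w) (t := 0) (by exact_mod_cast hf.contDiffAt)
    simp only [ih (hf.of_le (by norm_cast; lia))] at deriv_line
    rw [((hasDerivAt_taylorTerm hf x w 0).const_mul _).deriv, zero_smul, add_zero] at deriv_line
    rw [← deriv_line, Nat.factorial_succ]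
    push_cast
    ring

/-- The integral remainder in Taylor's formula of order `N` for `f (x + w)`. -/
noncomputable def taylorRemainder (N : ℕ) (f : (Fin p → ℝ) → ℝ) (x w : Fin p → ℝ) : ℝ :=
  N * ∫ s in (0 : ℝ)..1, (1 - s) ^ (N - 1) * taylorTerm N f (x + s • w) w

theorem eq_sum_taylorTerm_add_taylorRemainder {f : (Fin p → ℝ) → ℝ} {N : ℕ} (hN : N ≠ 0)
    (hf : ContDiff ℝ N f) (x w : Fin p → ℝ) :
    f (x + w) = ∑ k ∈ range N, taylorTerm k f x w + taylorRemainder N f x w := by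
  obtain ⟨n, rfl⟩ := Nat.exists_eq_succ_of_ne_zero hN
  rw [map_add_eq_sum_add_integral_iteratedFDeriv (n := n) (f := f) (x := x) (y := w)
    fun _ _ => by exact_mod_cast hf.contDiffAt]
  congr 1
  · refine sum_congr rfl fun k hk => ?_
    have hkn : k ≤ n + 1 := (mem_range.1 hk).le
    rw [iteratedFDeriv_apply_const_eq_taylorTerm (hf.of_le (by exact_mod_cast hkn)), smul_eq_mul,
      inv_mul_cancel_left₀ (by positivity)]
  · rw [taylorRemainder, smul_eq_mul, inv_mul_eq_iff_eq_mul₀ (by positivity),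
      ← intervalIntegral.integral_const_mul, ← intervalIntegral.integral_const_mul]
    refine intervalIntegral.integral_congr fun t _ => ?_
    simp only [iteratedFDeriv_apply_const_eq_taylorTerm hf, smul_eq_mul, Nat.factorial_succ,
      Nat.succ_sub_one]
    push_cast
    ring

end Taylor

/-! ### Integrals of mixed derivatives over boxes -/

section MixedDerivative

variable {p : ℕ}

/-- The difference of the values of `φ` at the endpoints of the `r`-th side of the box `[a, b]`. -/
noncomputable def endpointDiff (a b : Fin p → ℝ) (r : Fin p) (φ : (Fin p → ℝ) → ℝ) :
    (Fin p → ℝ) → ℝ :=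
  fun x => φ (Function.update x r (b r)) - φ (Function.update x r (a r))

/-- The integral of `φ` over the `r`-th side of the box `[a, b]`. -/
noncomputable def sideIntegral (a b : Fin p → ℝ) (r : Fin p) (φ : (Fin p → ℝ) → ℝ) :
    (Fin p → ℝ) → ℝ :=
  fun x => ∫ t in a r..b r, φ (Function.update x r t)

/-- `f` is the iterated partial derivative of `F` along the coordinates in a list, taken from its
head on. -/
def IsIteratedDeriv : List (Fin p) → ((Fin p → ℝ) → ℝ) → ((Fin p → ℝ) → ℝ) → Prop
  | [], F, f => F = f
  | r :: L, F, f => ∃ F' : (Fin p → ℝ) → ℝ,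
      (∀ x, HasLineDerivAt ℝ F (F' x) x (Pi.single r 1)) ∧ IsIteratedDeriv L F' f

theorem isIteratedDeriv_ofFn {n : ℕ} (σ : Fin n → Fin p) (G : Fin (n + 1) → (Fin p → ℝ) → ℝ)
    (hG : ∀ (i : Fin n) (x : Fin p → ℝ),
      HasLineDerivAt ℝ (G i.castSucc) (G i.succ x) x (Pi.single (σ i) 1)) :
    IsIteratedDeriv (List.ofFn σ) (G 0) (G (Fin.last n)) := by
  induction n with
  | zero => rfl
  | succ n ih =>
    rw [List.ofFn_succ]
    exact ⟨G 1, hG 0, ih (fun i => σ i.succ) (fun i => G i.succ) fun i => hG i.succ⟩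

theorem IsAntiderivative.exists_isIteratedDeriv {F f : (Fin p → ℝ) → ℝ}
    (h : IsAntiderivative F f) :
    ∃ L : List (Fin p), L.Nodup ∧ L.toFinset = univ ∧ IsIteratedDeriv L F f := by
  obtain ⟨σ, G, rfl, rfl, hG⟩ := h
  refine ⟨List.ofFn σ, List.nodup_ofFn.2 σ.injective, ?_, isIteratedDeriv_ofFn σ G hG⟩
  ext r
  simpa [List.mem_ofFn] using σ.surjective r

theorem IsIteratedDeriv.shiftedSum {L : List (Fin p)} {F f : (Fin p → ℝ) → ℝ}
    (h : IsIteratedDeriv L F f) (n : Fin p → ℕ) :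
    IsIteratedDeriv L (shiftedSum F n) (shiftedSum f n) := by
  induction L generalizing F with
  | nil => exact congrArg (AltSum.shiftedSum · n) h
  | cons r L ih =>
    obtain ⟨F', hF', hL⟩ := h
    refine ⟨AltSum.shiftedSum F' n, fun x => HasDerivAt.fun_sum fun k _ => ?_, ih hL⟩
    have term := hF' (fun q => k q + x q)
    unfold HasLineDerivAt at term
    convert term using 3 with t
    ext q
    simp [add_assoc]

theorem hasLineDerivAt_endpointDiff {F F' : (Fin p → ℝ) → ℝ} {q r : Fin p} (hqr : q ≠ r)
    (hF : ∀ x, HasLineDerivAt ℝ F (F' x) x (Pi.single q 1)) (a b x : Fin p → ℝ) :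
    HasLineDerivAt ℝ (endpointDiff a b r F) (endpointDiff a b r F' x) x (Pi.single q 1) := by
  have update_line (t c : ℝ) : Function.update (x + t • Pi.single q 1) r c =
      Function.update x r c + t • Pi.single q 1 := by
    rw [← add_zero c, Function.update_add]
    simp [Function.update_eq_self_iff, hqr.symm]
  unfold HasLineDerivAt endpointDiff
  simp only [update_line]
  exact (hF _).fun_sub (hF _)

theorem hasLineDerivAt_foldr_endpointDiff {F F' : (Fin p → ℝ) → ℝ} {q : Fin p}
    {L : List (Fin p)} (hq : q ∉ L) (hF : ∀ x, HasLineDerivAt ℝ F (F' x) x (Pi.single q 1))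
    (a b x : Fin p → ℝ) :
    HasLineDerivAt ℝ (L.foldr (endpointDiff a b) F) (L.foldr (endpointDiff a b) F' x) x
      (Pi.single q 1) := by
  induction L generalizing x with
  | nil => exact hF x
  | cons r L ih =>
    rw [List.mem_cons, not_or] at hq
    exact hasLineDerivAt_endpointDiff hq.1 (ih hq.2) a b x

theorem continuous_foldr_sideIntegral {φ : (Fin p → ℝ) → ℝ} (hφ : Continuous φ)
    (a b : Fin p → ℝ) (L : List (Fin p)) : Continuous (L.foldr (sideIntegral a b) φ) := by
  induction L with
  | nil => exact hφ
  | cons r L ih =>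
    refine intervalIntegral.continuous_parametric_intervalIntegral_of_continuous' ?_ _ _
    exact ih.comp (continuous_fst.update r continuous_snd)

theorem endpointDiff_eq_sideIntegral {F F' : (Fin p → ℝ) → ℝ} {r : Fin p} (hF' : Continuous F')
    (hF : ∀ x, HasLineDerivAt ℝ F (F' x) x (Pi.single r 1)) (a b : Fin p → ℝ) :
    endpointDiff a b r F = sideIntegral a b r F' := by
  ext x
  have hasDerivAt_update (t : ℝ) : HasDerivAt (fun t => F (Function.update x r t))
      (F' (Function.update x r t)) t := by
    have line := hF (Function.update x r t)
    unfold HasLineDerivAt at line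
    rw [← sub_self t] at line
    refine (line.comp_sub_const t t).congr_of_eventuallyEq (.of_forall fun s => congrArg F ?_)
    ext q
    obtain rfl | hqr := eq_or_ne q r <;> simp [*]
  have continuous_update : Continuous fun t => F' (Function.update x r t) :=
    hF'.comp (continuous_const.update r continuous_id)
  exact (intervalIntegral.integral_eq_sub_of_hasDerivAt (fun t _ => hasDerivAt_update t)
    (continuous_update.intervalIntegrable _ _)).symm

theorem foldr_endpointDiff_eq_foldr_sideIntegral {F f : (Fin p → ℝ) → ℝ} {L : List (Fin p)}
    (hL : L.Nodup) (hf : Continuous f) (h : IsIteratedDeriv L F f) (a b : Fin p → ℝ) :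
    L.foldr (endpointDiff a b) F = L.foldr (sideIntegral a b) f := by
  induction L generalizing F with
  | nil => exact h
  | cons r L ih =>
    obtain ⟨F', hF', hL'⟩ := h
    rw [List.nodup_cons] at hL
    refine endpointDiff_eq_sideIntegral (continuous_foldr_sideIntegral hf a b L) (fun x => ?_) a b
    rw [← ih hL.2 hL']
    exact hasLineDerivAt_foldr_endpointDiff hL.1 hF' a b x

theorem foldr_endpointDiff_apply {L : List (Fin p)} (hL : L.Nodup) (F : (Fin p → ℝ) → ℝ)
    (a b x : Fin p → ℝ) :
    L.foldr (endpointDiff a b) F x = ∑ J ∈ L.toFinset.powerset, (-1 : ℝ) ^ (L.length - #J) *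
      F (L.toFinset.piecewise (J.piecewise b a) x) := by
  induction L generalizing x with
  | nil =>
    rw [List.toFinset_nil, powerset_empty, sum_singleton, piecewise_empty]
    simp
  | cons q L ih =>
    rw [List.nodup_cons] at hL
    have hq : q ∉ L.toFinset := by simpa using hL.1
    rw [List.foldr_cons, endpointDiff, ih hL.2, ih hL.2, List.toFinset_cons,
      sum_powerset_insert hq, List.length_cons, sub_eq_neg_add, ← sum_neg_distrib]
    congr 1 <;> refine sum_congr rfl fun J hJ => ?_ <;>
      have hqJ : q ∉ J := fun mem => hq (mem_powerset.1 hJ mem)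
    · have card_le : #J ≤ L.length :=
        (card_le_card (mem_powerset.1 hJ)).trans (List.toFinset_card_le L)
      rw [Nat.succ_sub card_le, pow_succ, mul_neg_one, neg_mul, piecewise_insert,
        update_piecewise_of_notMem _ _ _ hq, piecewise_eq_of_notMem _ _ _ hqJ]
    · rw [card_insert_of_notMem hqJ, Nat.add_sub_add_right, piecewise_insert, piecewise_insert,
        update_piecewise_of_notMem _ _ _ hq, Function.update_self]
      congr 2
      refine piecewise_congr _ (fun r hr => ?_) fun _ _ => rfl
      rw [Function.update_of_ne (ne_of_mem_of_not_mem hr hq)]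

end MixedDerivative

section BoxIntegral

theorem preimage_update_univ_pi {ι : Type*} [DecidableEq ι] {X : ι → Type*} (s : ∀ i, Set (X i))
    (r : ι) :
    (fun q : (∀ i, X i) × X r => Function.update q.1 r q.2) ⁻¹' Set.univ.pi s =
      Set.univ.pi (Function.update s r Set.univ) ×ˢ s r := by
  ext ⟨x, t⟩
  simp only [Set.mem_preimage, Set.mem_univ_pi, Set.mem_prod]
  rw [Function.forall_update_iff x fun i y => y ∈ s i,
    Function.forall_update_iff s fun i S => x i ∈ S]
  simp [and_comm]

theorem map_update_prod_pi {ι : Type*} [Fintype ι] [DecidableEq ι] {X : ι → Type*}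
    [∀ i, MeasurableSpace (X i)] (ν : ∀ i, Measure (X i)) [∀ i, IsFiniteMeasure (ν i)] (r : ι) :
    ((Measure.pi ν).prod (ν r)).map (fun q => Function.update q.1 r q.2) =
      ν r Set.univ • Measure.pi ν := by
  obtain hν | hν := eq_or_ne (ν r) 0
  · simp [hν]
  have mass_ne_zero : ν r Set.univ ≠ 0 := by simpa using hν
  have mass_ne_top : ν r Set.univ ≠ ⊤ := measure_ne_top _ _
  suffices h : Measure.pi ν = (ν r Set.univ)⁻¹ •
      ((Measure.pi ν).prod (ν r)).map (fun q => Function.update q.1 r q.2) by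
    conv_rhs => rw [h]
    rw [smul_smul, ENNReal.mul_inv_cancel mass_ne_zero mass_ne_top, one_smul]
  refine Measure.pi_eq fun s hs => ?_
  have measure_away : ∏ i ∈ univ.erase r, ν i (Function.update s r Set.univ i) =
      ∏ i ∈ univ.erase r, ν i (s i) :=
    prod_congr rfl fun i hi => by rw [Function.update_of_ne (ne_of_mem_erase hi)]
  rw [Measure.smul_apply, Measure.map_apply (by fun_prop) (MeasurableSet.univ_pi hs),
    preimage_update_univ_pi, Measure.prod_prod, Measure.pi_pi, smul_eq_mul,
    ← mul_prod_erase univ _ (mem_univ r), ← mul_prod_erase univ (fun i => ν i (s i)) (mem_univ r),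
    measure_away, Function.update_self, mul_assoc,
    ENNReal.inv_mul_cancel_left mass_ne_zero mass_ne_top, mul_comm]

variable {p : ℕ} {a b : Fin p → ℝ}

theorem volume_restrict_Icc (a b : Fin p → ℝ) : (volume : Measure (Fin p → ℝ)).restrict
    (Set.Icc a b) = Measure.pi fun r => volume.restrict (Set.Icc (a r) (b r)) := by
  rw [← Set.pi_univ_Icc, volume_pi, Measure.restrict_pi_pi]

theorem integral_Icc_sideIntegral (hab : a ≤ b) {φ : (Fin p → ℝ) → ℝ} (hφ : Continuous φ)
    (r : Fin p) :
    ∫ x in Set.Icc a b, sideIntegral a b r φ x = (b r - a r) * ∫ x in Set.Icc a b, φ x := by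
  let ν (i : Fin p) : Measure ℝ := volume.restrict (Set.Icc (a i) (b i))
  have volume_restrict : volume.restrict (Set.Icc a b) = Measure.pi ν := volume_restrict_Icc a b
  have mass : ν r Set.univ = ENNReal.ofReal (b r - a r) := by simp [ν]
  have continuous_update : Continuous fun q : (Fin p → ℝ) × ℝ => Function.update q.1 r q.2 :=
    continuous_fst.update r continuous_snd
  have integrable : Integrable φ (Measure.pi ν) := by
    rw [← volume_restrict]
    exact hφ.continuousOn.integrableOn_compact isCompact_Icc
  have integrable_update : Integrable (fun q : (Fin p → ℝ) × ℝ => φ (Function.update q.1 r q.2))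
      ((Measure.pi ν).prod (ν r)) := by
    refine (integrable_map_measure hφ.aestronglyMeasurable
      continuous_update.measurable.aemeasurable).1 ?_
    rw [map_update_prod_pi]
    exact integrable.smul_measure (measure_ne_top _ _)
  calc ∫ x in Set.Icc a b, sideIntegral a b r φ x
      = ∫ x, ∫ t, φ (Function.update x r t) ∂ν r ∂Measure.pi ν := by
        simp only [volume_restrict, sideIntegral, ν, intervalIntegral.integral_of_le (hab r),
          integral_Icc_eq_integral_Ioc]
    _ = ∫ x, φ x ∂((Measure.pi ν).prod (ν r)).map fun q => Function.update q.1 r q.2 := by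
        rw [integral_map continuous_update.measurable.aemeasurable hφ.aestronglyMeasurable,
          integral_prod _ integrable_update]
    _ = (b r - a r) * ∫ x in Set.Icc a b, φ x := by
        rw [map_update_prod_pi, integral_smul_measure, mass,
          ENNReal.toReal_ofReal (sub_nonneg.2 (hab r)), volume_restrict, smul_eq_mul]

theorem integral_Icc_foldr_sideIntegral (hab : a ≤ b) {φ : (Fin p → ℝ) → ℝ} (hφ : Continuous φ)
    (L : List (Fin p)) :
    ∫ x in Set.Icc a b, L.foldr (sideIntegral a b) φ x =
      (L.map (b - a)).prod * ∫ x in Set.Icc a b, φ x := by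
  induction L with
  | nil => simp
  | cons r L ih =>
    rw [List.foldr_cons, integral_Icc_sideIntegral hab (continuous_foldr_sideIntegral hφ a b L),
      ih, List.map_cons, List.prod_cons, mul_assoc, Pi.sub_apply]

theorem IsIteratedDeriv.integral_Icc {F f : (Fin p → ℝ) → ℝ} {L : List (Fin p)}
    (h : IsIteratedDeriv L F f) (hL : L.Nodup) (hall : L.toFinset = univ) (hf : Continuous f)
    (hab : ∀ r, a r < b r) :
    ∫ x in Set.Icc a b, f x =
      ∑ J : Finset (Fin p), (-1 : ℝ) ^ (p - #J) * F (J.piecewise b a) := by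
  have length : L.length = p := by
    rw [← List.toFinset_card_of_nodup hL, hall, card_univ, Fintype.card_fin]
  have volume_box : volume.real (Set.Icc a b) = (L.map (b - a)).prod := by
    rw [Measure.real, Real.volume_Icc_pi_toReal fun r => (hab r).le, ← List.prod_toFinset _ hL,
      hall]
    rfl
  have volume_ne_zero : (L.map (b - a)).prod ≠ 0 := by
    rw [← List.prod_toFinset _ hL, hall]
    exact (prod_pos fun r _ => sub_pos.2 (hab r)).ne'
  have average := integral_Icc_foldr_sideIntegral (fun r => (hab r).le) hf L
  rw [← foldr_endpointDiff_eq_foldr_sideIntegral hL hf h] at average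
  have vertex (J : Finset (Fin p)) (x : Fin p → ℝ) :
      L.toFinset.piecewise (J.piecewise b a) x = J.piecewise b a :=
    funext fun r => L.toFinset.piecewise_eq_of_mem _ _ (hall ▸ mem_univ r)
  -- The alternating sum over the vertices does not depend on the point, so its integral over the
  -- box is its value times the volume.
  simp only [foldr_endpointDiff_apply hL, length, vertex, hall, powerset_univ, setIntegral_const,
    volume_box, smul_eq_mul] at average
  exact (mul_left_cancel₀ volume_ne_zero average).symm

end BoxIntegral

/-! ### Reproduction of values at the origin -/

section ShiftedSum

variable {p : ℕ}

theorem continuous_shiftedSum {g : (Fin p → ℝ) → ℝ} (hg : Continuous g) (n : Fin p → ℕ) :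
    Continuous (shiftedSum g n) := by
  unfold shiftedSum
  fun_prop

theorem contDiff_shiftedSum {g : (Fin p → ℝ) → ℝ} {N : WithTop ℕ∞} (hg : ContDiff ℝ N g)
    (n : Fin p → ℕ) : ContDiff ℝ N (shiftedSum g n) :=
  ContDiff.sum fun _ _ => hg.comp (contDiff_const.add contDiff_id)

theorem partialDeriv_shiftedSum {g : (Fin p → ℝ) → ℝ} (hg : Differentiable ℝ g)
    (n : Fin p → ℕ) (r : Fin p) :
    partialDeriv r (shiftedSum g n) = shiftedSum (partialDeriv r g) n := by
  have iterated : IsIteratedDeriv [r] g (partialDeriv r g) :=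
    ⟨_, fun x => (hg x).lineDifferentiableAt.hasLineDerivAt, rfl⟩
  obtain ⟨_, hasLineDerivAt, rfl⟩ := iterated.shiftedSum n
  exact funext fun x => (hasLineDerivAt x).lineDeriv

theorem iterate_partialDeriv_shiftedSum {g : (Fin p → ℝ) → ℝ} {a : ℕ} (hg : ContDiff ℝ a g)
    (n : Fin p → ℕ) (r : Fin p) :
    (partialDeriv r)^[a] (shiftedSum g n) = shiftedSum ((partialDeriv r)^[a] g) n := by
  induction a with
  | zero => rfl
  | succ a ih =>
    rw [Function.iterate_succ_apply', Function.iterate_succ_apply',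
      ih (hg.of_le (by norm_cast; lia)), partialDeriv_shiftedSum]
    refine (contDiff_iterate_partialDeriv (n := 1) ?_ r).differentiable (by simp)
    rwa [add_comm 1]

theorem multiDerivOn_shiftedSum {g : (Fin p → ℝ) → ℝ} {α : Fin p → ℕ} {L : List (Fin p)}
    (hg : ContDiff ℝ (L.map α).sum g) (n : Fin p → ℕ) :
    multiDerivOn L α (shiftedSum g n) = shiftedSum (multiDerivOn L α g) n := by
  induction L with
  | nil => rfl
  | cons r L ih =>
    rw [List.map_cons, List.sum_cons] at hg
    change (partialDeriv r)^[α r] (multiDerivOn L α (shiftedSum g n)) =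
      shiftedSum ((partialDeriv r)^[α r] (multiDerivOn L α g)) n
    rw [ih (hg.of_le (by norm_cast; lia)),
      iterate_partialDeriv_shiftedSum (contDiff_multiDerivOn L hg)]

theorem multiDeriv_shiftedSum {g : (Fin p → ℝ) → ℝ} {α : Fin p → ℕ}
    (hg : ContDiff ℝ (∑ r, α r : ℕ) g) (n : Fin p → ℕ) :
    multiDeriv α (shiftedSum g n) = shiftedSum (multiDeriv α g) n :=
  multiDerivOn_shiftedSum (by rwa [sum_map_finRange]) n

end ShiftedSum

section ProductIntegral

variable {p : ℕ}

theorem integral_Icc_prod_apply {a b : Fin p → ℝ} (hab : a ≤ b) (φ : Fin p → ℝ → ℝ) :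
    ∫ x in Set.Icc a b, ∏ r, φ r (x r) = ∏ r, ∫ t in a r..b r, φ r t := by
  rw [volume_restrict_Icc, integral_fintype_prod_eq_prod]
  exact prod_congr rfl fun r _ => by
    rw [integral_Icc_eq_integral_Ioc, intervalIntegral.integral_of_le (hab r)]

theorem integral_Icc_neg_self_eq {c : Fin p → ℝ} (hc : ∀ r, 0 < c r) {φ : (Fin p → ℝ) → ℝ}
    (hφ : Continuous φ) :
    ∫ x in Set.Icc (-c) c, φ x = (∏ r, c r) * ∫ v in Set.Icc (-1) 1, φ (c * v) := by
  have prod_pos : 0 < ∏ r, c r := Finset.prod_pos fun r _ => hc r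
  have map_mul : Measure.map (c * ·) volume = ENNReal.ofReal (∏ r, c r)⁻¹ • volume := by
    have det : (Matrix.diagonal c).det = ∏ r, c r := Matrix.det_diagonal
    have map_diagonal := Real.map_matrix_volume_pi_eq_smul_volume_pi (det.trans_ne prod_pos.ne')
    rw [det, abs_of_pos (inv_pos.2 prod_pos)] at map_diagonal
    rw [← map_diagonal]
    congr 1
    ext v r
    simp [Matrix.mulVec_diagonal]
  have preimage_Icc : (c * ·) ⁻¹' Set.Icc (-c) c = Set.Icc (-1) 1 := by
    ext v
    simp only [Set.mem_preimage, Set.mem_Icc, Pi.le_def, Pi.mul_apply, Pi.neg_apply, Pi.one_apply]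
    refine and_congr (forall_congr' fun r => ?_) (forall_congr' fun r => ?_)
    · rw [← mul_neg_one, mul_le_mul_iff_right₀ (hc r)]
    · rw [mul_le_iff_le_one_right (hc r)]
  rw [← preimage_Icc, ← setIntegral_map measurableSet_Icc hφ.aestronglyMeasurable
    (by fun_prop), map_mul, Measure.restrict_smul, integral_smul_measure,
    ENNReal.toReal_ofReal (inv_nonneg.2 prod_pos.le), smul_eq_mul,
    mul_inv_cancel_left₀ prod_pos.ne']

end ProductIntegral

section GammaIntegral

variable {p : ℕ} {m : ℕ} {φ ψ : (Fin p → ℝ) → ℝ}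

/-- The box `∏ r, [-j r / 2, j r / 2]`. -/
def centeredBox (j : Fin p → ℕ) : Set (Fin p → ℝ) :=
  Set.Icc (-fun r => (j r : ℝ) / 2) fun r => (j r : ℝ) / 2

/-- The linear combination, with coefficients `γ_{m,j}`, of the integrals of `φ` over the boxes
`∏ r, [-j r / 2, j r / 2]`.  It evaluates polynomials of degree less than `2 * m` at `0`. -/
noncomputable def gammaIntegral (m : ℕ) (φ : (Fin p → ℝ) → ℝ) : ℝ :=
  ∑ j ∈ Icc (1 : Fin p → ℕ) (fun _ => m), gammaCoeff m j * ∫ w in centeredBox j, φ w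

theorem isCompact_centeredBox (j : Fin p → ℕ) : IsCompact (centeredBox j) := isCompact_Icc

theorem integrableOn_centeredBox (hφ : Continuous φ) (j : Fin p → ℕ) :
    IntegrableOn φ (centeredBox j) :=
  hφ.continuousOn.integrableOn_compact (isCompact_centeredBox j)

theorem integral_centeredBox_prod_apply (φ : Fin p → ℝ → ℝ) (j : Fin p → ℕ) :
    ∫ w in centeredBox j, ∏ r, φ r (w r) = ∏ r, ∫ t in -((j r : ℝ) / 2)..(j r : ℝ) / 2, φ r t :=
  integral_Icc_prod_apply (fun r => neg_le_self (by positivity)) φ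

theorem gammaIntegral_const_mul (c : ℝ) (φ : (Fin p → ℝ) → ℝ) :
    gammaIntegral m (fun w => c * φ w) = c * gammaIntegral m φ := by
  simp only [gammaIntegral, integral_const_mul, mul_sum, mul_left_comm]

theorem gammaIntegral_finsetSum {ι : Type*} (s : Finset ι) {φ : ι → (Fin p → ℝ) → ℝ}
    (hφ : ∀ i ∈ s, Continuous (φ i)) :
    gammaIntegral m (fun w => ∑ i ∈ s, φ i w) = ∑ i ∈ s, gammaIntegral m (φ i) := by
  unfold gammaIntegral
  rw [sum_comm]
  refine sum_congr rfl fun j _ => ?_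
  rw [integral_finsetSum _ fun i hi => integrableOn_centeredBox (hφ i hi) j, mul_sum]

theorem gammaIntegral_add (hφ : Continuous φ) (hψ : Continuous ψ) :
    gammaIntegral m (fun w => φ w + ψ w) = gammaIntegral m φ + gammaIntegral m ψ := by
  simp only [gammaIntegral, ← sum_add_distrib, ← mul_add]
  exact sum_congr rfl fun j _ => by
    rw [integral_add (integrableOn_centeredBox hφ j) (integrableOn_centeredBox hψ j)]

theorem gammaIntegral_sub (hφ : Continuous φ) (hψ : Continuous ψ) :
    gammaIntegral m (fun w => φ w - ψ w) = gammaIntegral m φ - gammaIntegral m ψ := by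
  have neg_eq : gammaIntegral m (fun w => -1 * ψ w) = -1 * gammaIntegral m ψ :=
    gammaIntegral_const_mul _ _
  rw [sub_eq_add_neg, ← neg_one_mul, ← neg_eq, ← gammaIntegral_add hφ (by fun_prop)]
  simp only [neg_one_mul, sub_eq_add_neg]

theorem continuous_gammaIntegral {K : ℝ → (Fin p → ℝ) → ℝ}
    (hK : Continuous (Function.uncurry K)) : Continuous fun s => gammaIntegral m (K s) :=
  continuous_finsetSum _ fun j _ => continuous_const.mul
    (continuous_parametric_integral_of_continuous hK (isCompact_centeredBox j))

theorem gammaIntegral_intervalIntegral {K : ℝ → (Fin p → ℝ) → ℝ}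
    (hK : Continuous (Function.uncurry K)) {a b : ℝ} (hab : a ≤ b) :
    gammaIntegral m (fun w => ∫ s in a..b, K s w) = ∫ s in a..b, gammaIntegral m (K s) := by
  have swap (j : Fin p → ℕ) : ∫ w in centeredBox j, ∫ s in a..b, K s w =
      ∫ s in a..b, ∫ w in centeredBox j, K s w := by
    simp only [intervalIntegral.integral_of_le hab, ← integral_Icc_eq_integral_Ioc]
    refine (integral_integral_swap ?_).symm
    rw [Measure.prod_restrict]
    exact hK.continuousOn.integrableOn_compact (isCompact_Icc.prod (isCompact_centeredBox j))
  have continuous_integral (j : Fin p → ℕ) : Continuous fun s => ∫ w in centeredBox j, K s w :=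
    continuous_parametric_integral_of_continuous hK (isCompact_centeredBox j)
  simp only [gammaIntegral, swap]
  rw [intervalIntegral.integral_finsetSum fun j _ =>
    ((continuous_integral j).const_mul _).intervalIntegrable _ _]
  simp only [intervalIntegral.integral_const_mul]

theorem gammaIntegral_prod_pow {α : Fin p → ℕ} (hα : ∑ r, α r < 2 * m) :
    gammaIntegral m (fun w => ∏ r, w r ^ α r) = if α = 0 then 1 else 0 := by
  have moment (r : Fin p) : ∑ j ∈ Icc 1 m, gamma1 m j *
      ((((j : ℝ) / 2) ^ (α r + 1) - (-((j : ℝ) / 2)) ^ (α r + 1)) / (α r + 1)) =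
      if α r = 0 then 1 else 0 := by
    have apply_le : α r ≤ ∑ r, α r := single_le_sum (fun _ _ => Nat.zero_le _) (mem_univ r)
    simp only [← mul_div_assoc]
    rw [← sum_div, sum_gamma1_mul_pow_sub (by lia)]
    obtain h | h := eq_or_ne (α r) 0 <;> simp [h]
  simp only [gammaIntegral, gammaCoeff,
    integral_centeredBox_prod_apply (fun r t => t ^ α r), integral_pow, ← prod_mul_distrib]
  rw [Pi.Icc_eq]
  simp only [Pi.one_apply]
  rw [← prod_univ_sum (fun _ => Icc 1 m) fun r j => gamma1 m j *
    ((((j : ℝ) / 2) ^ (α r + 1) - (-((j : ℝ) / 2)) ^ (α r + 1)) / (α r + 1))]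
  simp only [moment, prod_ite_zero, prod_const_one, mem_univ, true_imp_iff, funext_iff,
    Pi.zero_apply]

theorem gammaIntegral_taylorTerm {k : ℕ} (hk : k < 2 * m) (g : (Fin p → ℝ) → ℝ) :
    gammaIntegral m (taylorTerm k g 0) = if k = 0 then g 0 else 0 := by
  have monomial (α : Fin p → ℕ) (hα : α ∈ multiIndices p k) :
      gammaIntegral m (fun w => (∏ q, w q ^ α q / (α q).factorial) * multiDeriv α g 0) =
        if α = 0 then g 0 else 0 := by
    rw [mem_multiIndices] at hα
    have factor (w : Fin p → ℝ) : (∏ q, w q ^ α q / (α q).factorial) * multiDeriv α g 0 =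
        multiDeriv α g 0 / (∏ q, ((α q).factorial : ℝ)) * ∏ q, w q ^ α q := by
      rw [prod_div_distrib]
      ring
    simp only [factor]
    rw [gammaIntegral_const_mul, gammaIntegral_prod_pow (hα ▸ hk)]
    obtain rfl | h := eq_or_ne α 0 <;> simp [multiDeriv_zero, *]
  unfold taylorTerm
  rw [gammaIntegral_finsetSum _ fun α _ => by fun_prop, sum_congr rfl monomial, sum_ite_eq']
  simp only [mem_multiIndices, Pi.zero_apply, sum_const_zero, eq_comm (a := 0)]

theorem IsIteratedDeriv.gammaIntegral_eq {L : List (Fin p)} {G g : (Fin p → ℝ) → ℝ}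
    (h : IsIteratedDeriv L G g) (hL : L.Nodup) (hall : L.toFinset = univ) (hg : Continuous g)
    (m : ℕ) :
    gammaIntegral m g = ∑ j ∈ Icc (1 : Fin p → ℕ) (fun _ => m), gammaCoeff m j *
      ∑ J : Finset (Fin p), (-1) ^ (p - #J) *
        G (fun r => if r ∈ J then (j r : ℝ) / 2 else -((j r : ℝ) / 2)) := by
  refine sum_congr rfl fun j hj => congrArg (gammaCoeff m j * ·) (h.integral_Icc hL hall hg
    fun r => neg_lt_self ?_)
  have : 0 < j r := (mem_Icc.1 hj).1 r
  positivity

end GammaIntegral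

/-! ### The remainder functional -/

section Remainder

variable {p : ℕ} {m : ℕ}

/-- The remainder `R_{m,f}(∞)` with an arbitrary family `Φ α` of functions in place of the series
of the derivatives `f^(α)`. -/
noncomputable def remainderOf (m : ℕ) (Φ : (Fin p → ℕ) → (Fin p → ℝ) → ℝ) : ℝ :=
  (m : ℝ) / 2 ^ (2 * m + p - 1) *
    ∑ α ∈ multiIndices p (2 * m), 1 / (∏ r, ((α r).factorial : ℝ)) *
      ∫ s in (0 : ℝ)..1, (1 - s) ^ (2 * m - 1) *
        ∫ v in Set.Icc (-1 : Fin p → ℝ) 1, (∏ r, v r ^ α r) *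
          ∑ j ∈ Icc (1 : Fin p → ℕ) (fun _ => m), gammaCoeff m j *
            (∏ r, (j r : ℝ) ^ (α r + 1)) * Φ α (fun r => s * (j r : ℝ) * v r / 2)

/-- The integral-remainder functional attached to one multi-index `α`, applied to `φ`. -/
noncomputable def remainderTerm (m : ℕ) (α : Fin p → ℕ) (φ : (Fin p → ℝ) → ℝ) : ℝ :=
  ∫ s in (0 : ℝ)..1, (1 - s) ^ (2 * m - 1) *
    gammaIntegral m fun w => (∏ r, w r ^ α r) * φ (s • w)

theorem integral_centeredBox_prod_pow_mul {j : Fin p → ℕ} (hj : ∀ r, 0 < j r)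
    {φ : (Fin p → ℝ) → ℝ} (hφ : Continuous φ) (α : Fin p → ℕ) :
    ∫ w in centeredBox j, (∏ r, w r ^ α r) * φ w =
      (2 ^ (∑ r, α r + p))⁻¹ * (∏ r, (j r : ℝ) ^ (α r + 1)) *
        ∫ v in Set.Icc (-1 : Fin p → ℝ) 1,
          (∏ r, v r ^ α r) * φ (fun r => (j r : ℝ) / 2 * v r) := by
  have half_pos (r : Fin p) : 0 < (j r : ℝ) / 2 := by
    have := hj r
    positivity
  have scale : (∏ r, (j r : ℝ) / 2) * ∏ r, ((j r : ℝ) / 2) ^ α r =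
      (2 ^ (∑ r, α r + p))⁻¹ * ∏ r, (j r : ℝ) ^ (α r + 1) := by
    simp only [← prod_mul_distrib, ← pow_succ']
    simp only [div_pow]
    rw [prod_div_distrib, prod_pow_eq_pow_sum, sum_add_distrib, sum_const, card_univ,
      Fintype.card_fin, smul_eq_mul, mul_one, div_eq_inv_mul]
  rw [centeredBox, integral_Icc_neg_self_eq half_pos (by fun_prop), ← scale, mul_assoc]
  simp only [Pi.mul_apply, mul_pow, prod_mul_distrib, mul_assoc]
  rw [integral_const_mul]
  rfl

theorem gammaIntegral_prod_pow_mul {φ : (Fin p → ℝ) → ℝ} (hφ : Continuous φ) (α : Fin p → ℕ) :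
    gammaIntegral m (fun w => (∏ r, w r ^ α r) * φ w) = (2 ^ (∑ r, α r + p))⁻¹ *
      ∫ v in Set.Icc (-1 : Fin p → ℝ) 1, (∏ r, v r ^ α r) *
        ∑ j ∈ Icc (1 : Fin p → ℕ) (fun _ => m), gammaCoeff m j *
          (∏ r, (j r : ℝ) ^ (α r + 1)) * φ (fun r => (j r : ℝ) / 2 * v r) := by
  have integrable (j : Fin p → ℕ) : IntegrableOn (fun v : Fin p → ℝ => gammaCoeff m j *
      (∏ r, (j r : ℝ) ^ (α r + 1)) * ((∏ r, v r ^ α r) * φ (fun r => (j r : ℝ) / 2 * v r)))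
      (Set.Icc (-1) 1) :=
    Continuous.continuousOn (by fun_prop) |>.integrableOn_compact isCompact_Icc
  simp only [mul_sum, mul_left_comm (∏ r, _ ^ α r)]
  rw [integral_finsetSum _ fun j _ => integrable j, mul_sum, gammaIntegral]
  refine sum_congr rfl fun j hj => ?_
  rw [integral_centeredBox_prod_pow_mul (mem_Icc.1 hj).1 hφ, integral_const_mul]
  ring

theorem mul_mul_div_two_eq_smul (s : ℝ) (j : Fin p → ℕ) (v : Fin p → ℝ) :
    (fun r => s * (j r : ℝ) * v r / 2) = s • fun r => (j r : ℝ) / 2 * v r := by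
  ext r
  rw [Pi.smul_apply, smul_eq_mul]
  ring

theorem remainderOf_eq_sum_remainderTerm (hm : m ≠ 0)
    {Φ : (Fin p → ℕ) → (Fin p → ℝ) → ℝ} (hΦ : ∀ α ∈ multiIndices p (2 * m), Continuous (Φ α)) :
    remainderOf m Φ = ∑ α ∈ multiIndices p (2 * m),
      2 * m / (∏ r, ((α r).factorial : ℝ)) * remainderTerm m α (Φ α) := by
  unfold remainderOf
  rw [mul_sum]
  refine sum_congr rfl fun α hα => ?_
  have inner (s : ℝ) : ∫ v in Set.Icc (-1 : Fin p → ℝ) 1, (∏ r, v r ^ α r) *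
      ∑ j ∈ Icc (1 : Fin p → ℕ) (fun _ => m), gammaCoeff m j *
        (∏ r, (j r : ℝ) ^ (α r + 1)) * Φ α (fun r => s * (j r : ℝ) * v r / 2) =
      2 ^ (2 * m + p) * gammaIntegral m fun w => (∏ r, w r ^ α r) * Φ α (s • w) := by
    have := hΦ α hα
    rw [gammaIntegral_prod_pow_mul (by fun_prop) α, mem_multiIndices.1 hα,
      mul_inv_cancel_left₀ (by positivity)]
    simp only [mul_mul_div_two_eq_smul]
  have power : (2 : ℝ) ^ (2 * m + p) = 2 ^ (2 * m + p - 1) * 2 := by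
    rw [← pow_succ]
    congr 1
    lia
  simp only [inner, mul_left_comm _ ((2 : ℝ) ^ (2 * m + p))]
  rw [intervalIntegral.integral_const_mul, power, remainderTerm]
  field_simp

theorem continuous_gammaIntegral_prod_pow_mul {φ : (Fin p → ℝ) → ℝ} (hφ : Continuous φ)
    (α : Fin p → ℕ) :
    Continuous fun s : ℝ => gammaIntegral m fun w => (∏ r, w r ^ α r) * φ (s • w) :=
  continuous_gammaIntegral (by simp only [Function.uncurry_def]; fun_prop)

theorem gammaIntegral_taylorRemainder {g : (Fin p → ℝ) → ℝ} (hm : m ≠ 0)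
    (hg : ContDiff ℝ (2 * m : ℕ) g) :
    gammaIntegral m (taylorRemainder (2 * m) g 0) = remainderOf m fun α => multiDeriv α g := by
  have continuous_deriv (α : Fin p → ℕ) (hα : α ∈ multiIndices p (2 * m)) :
      Continuous (multiDeriv α g) := continuous_multiDeriv (by rwa [mem_multiIndices.1 hα])
  have term (s : ℝ) : gammaIntegral m (fun w => taylorTerm (2 * m) g (0 + s • w) w) =
      ∑ α ∈ multiIndices p (2 * m), (∏ r, ((α r).factorial : ℝ))⁻¹ *
        gammaIntegral m fun w => (∏ r, w r ^ α r) * multiDeriv α g (s • w) := by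
    simp only [taylorTerm, zero_add, prod_div_distrib, div_mul_eq_mul_div]
    rw [gammaIntegral_finsetSum _ fun α hα => ?_]
    · simp only [div_eq_inv_mul, gammaIntegral_const_mul]
    · have := continuous_deriv α hα
      fun_prop
  have continuous_term (α : Fin p → ℕ) (hα : α ∈ multiIndices p (2 * m)) :
      Continuous fun s : ℝ =>
        gammaIntegral m fun w => (∏ r, w r ^ α r) * multiDeriv α g (s • w) :=
    continuous_gammaIntegral_prod_pow_mul (continuous_deriv α hα) α
  have continuous_integrand : Continuous (Function.uncurry fun (s : ℝ) (w : Fin p → ℝ) =>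
      (1 - s) ^ (2 * m - 1) * taylorTerm (2 * m) g (0 + s • w) w) := by
    simp only [Function.uncurry_def, taylorTerm]
    refine Continuous.mul (by fun_prop) (continuous_finsetSum _ fun α hα => ?_)
    have := continuous_deriv α hα
    fun_prop
  unfold taylorRemainder
  rw [gammaIntegral_const_mul, gammaIntegral_intervalIntegral continuous_integrand zero_le_one,
    remainderOf_eq_sum_remainderTerm hm continuous_deriv]
  simp only [gammaIntegral_const_mul, term, mul_sum]
  rw [intervalIntegral.integral_finsetSum fun α hα => ?_, mul_sum]
  · refine sum_congr rfl fun α _ => ?_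
    simp only [mul_left_comm (_ ^ (2 * m - 1))]
    rw [intervalIntegral.integral_const_mul, remainderTerm]
    push_cast
    ring
  · have := continuous_term α hα
    exact Continuous.intervalIntegrable (by fun_prop) _ _

theorem IsIteratedDeriv.apply_zero_eq {L : List (Fin p)} {G g : (Fin p → ℝ) → ℝ} (hm : m ≠ 0)
    (h : IsIteratedDeriv L G g) (hL : L.Nodup) (hall : L.toFinset = univ)
    (hg : ContDiff ℝ (2 * m : ℕ) g) :
    g 0 = ∑ j ∈ Icc (1 : Fin p → ℕ) (fun _ => m), gammaCoeff m j *
        ∑ J : Finset (Fin p), (-1) ^ (p - #J) *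
          G (fun r => if r ∈ J then (j r : ℝ) / 2 else -((j r : ℝ) / 2)) -
      remainderOf m fun α => multiDeriv α g := by
  have continuous_taylorTerm (k : ℕ) : Continuous (taylorTerm k g 0) := by
    unfold taylorTerm
    fun_prop
  have taylor (w : Fin p → ℝ) :
      g w = ∑ k ∈ range (2 * m), taylorTerm k g 0 w + taylorRemainder (2 * m) g 0 w := by
    rw [← eq_sum_taylorTerm_add_taylorRemainder (by lia) hg, zero_add]
  have continuous_remainder : Continuous (taylorRemainder (2 * m) g 0) := by
    have difference : taylorRemainder (2 * m) g 0 =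
        fun w => g w - ∑ k ∈ range (2 * m), taylorTerm k g 0 w :=
      funext fun w => eq_sub_of_add_eq' (taylor w).symm
    rw [difference]
    exact hg.continuous.sub (continuous_finsetSum _ fun k _ => continuous_taylorTerm k)
  rw [← gammaIntegral_taylorRemainder hm hg, ← h.gammaIntegral_eq hL hall hg.continuous,
    eq_sub_iff_add_eq]
  calc g 0 + gammaIntegral m (taylorRemainder (2 * m) g 0)
      = ∑ k ∈ range (2 * m), gammaIntegral m (taylorTerm k g 0) +
          gammaIntegral m (taylorRemainder (2 * m) g 0) := by
        rw [sum_congr rfl fun k hk => gammaIntegral_taylorTerm (mem_range.1 hk) g, sum_ite_eq',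
          if_pos (mem_range.2 (by lia))]
    _ = gammaIntegral m fun w =>
          ∑ k ∈ range (2 * m), taylorTerm k g 0 w + taylorRemainder (2 * m) g 0 w := by
        rw [gammaIntegral_add (continuous_finsetSum _ fun k _ => continuous_taylorTerm k)
          continuous_remainder, gammaIntegral_finsetSum _ fun k _ => continuous_taylorTerm k]
    _ = gammaIntegral m g := congrArg (gammaIntegral m) (funext fun w => (taylor w).symm)

theorem integral_abs_pow_neg_self {c : ℝ} (hc : 0 ≤ c) (a : ℕ) :
    ∫ t in -c..c, |t| ^ a = 2 * (c ^ (a + 1) / (a + 1)) := by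
  have right_half : ∫ t in 0..c, |t| ^ a = c ^ (a + 1) / (a + 1) := by
    have abs_eq : Set.EqOn (fun t : ℝ => |t| ^ a) (fun t => t ^ a) (Set.uIcc 0 c) := fun t ht => by
      simp only [abs_of_nonneg (Set.uIcc_of_le hc ▸ ht).1]
    rw [intervalIntegral.integral_congr abs_eq, integral_pow]
    simp
  have left_half : ∫ t in -c..0, |t| ^ a = ∫ t in 0..c, |t| ^ a := by
    simpa using (intervalIntegral.integral_comp_neg (a := 0) (b := c) fun t => |t| ^ a).symm
  have integrable (x y : ℝ) : IntervalIntegrable (fun t : ℝ => |t| ^ a) volume x y :=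
    Continuous.intervalIntegrable (by fun_prop) x y
  rw [← intervalIntegral.integral_add_adjacent_intervals (integrable (-c) 0) (integrable 0 c),
    left_half, right_half, two_mul]

theorem smul_mem_centeredBox {j : Fin p → ℕ} {w : Fin p → ℝ} (hw : w ∈ centeredBox j) {s : ℝ}
    (hs : s ∈ Set.Icc 0 1) : s • w ∈ centeredBox j := by
  refine (convex_Icc _ _).smul_mem_of_zero_mem ⟨fun r => ?_, fun r => ?_⟩ hw hs
  · exact neg_nonpos.2 (by positivity)
  · rw [Pi.zero_apply]
    positivity

theorem abs_integral_centeredBox_prod_pow_mul_le {j : Fin p → ℕ} {φ : (Fin p → ℝ) → ℝ} {M : ℝ}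
    (hφ : ∀ w ∈ centeredBox j, |φ w| ≤ M) (α : Fin p → ℕ) :
    |∫ w in centeredBox j, (∏ r, w r ^ α r) * φ w| ≤
      M * ((2 ^ ∑ r, α r)⁻¹ * ∏ r, (j r : ℝ) ^ (α r + 1) / (α r + 1)) := by
  have moment (r : Fin p) : ∫ t in -((j r : ℝ) / 2)..(j r : ℝ) / 2, |t| ^ α r =
      (2 ^ α r)⁻¹ * ((j r : ℝ) ^ (α r + 1) / (α r + 1)) := by
    rw [integral_abs_pow_neg_self (by positivity), div_pow, pow_succ 2]
    field_simp
  have moments : ∫ w in centeredBox j, M * ∏ r, |w r| ^ α r =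
      M * ((2 ^ ∑ r, α r)⁻¹ * ∏ r, (j r : ℝ) ^ (α r + 1) / (α r + 1)) := by
    rw [integral_const_mul, integral_centeredBox_prod_apply fun r t => |t| ^ α r]
    simp only [moment, prod_mul_distrib, prod_inv_distrib, prod_pow_eq_pow_sum]
  rw [← moments, ← norm_eq_abs]
  refine norm_integral_le_of_norm_le (integrableOn_centeredBox (by fun_prop) j) ?_
  refine (ae_restrict_mem measurableSet_Icc).mono fun w hw => ?_
  simp only [norm_mul, norm_prod, norm_pow, norm_eq_abs]
  rw [mul_comm]
  exact mul_le_mul_of_nonneg_right (hφ w hw) (by positivity)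

theorem centeredBox_subset {j : Fin p → ℕ} (hj : ∀ r, j r ≤ m) :
    centeredBox j ⊆ centeredBox fun _ => m := by
  have half_le (r : Fin p) : (j r : ℝ) / 2 ≤ (m : ℝ) / 2 := by
    have : (j r : ℝ) ≤ m := mod_cast hj r
    gcongr
  exact Set.Icc_subset_Icc (neg_le_neg half_le) half_le

theorem abs_gammaIntegral_prod_pow_mul_le {φ : (Fin p → ℝ) → ℝ} {M : ℝ}
    (hφ : ∀ w ∈ centeredBox fun _ => m, |φ w| ≤ M) (α : Fin p → ℕ) :
    |gammaIntegral m fun w => (∏ r, w r ^ α r) * φ w| ≤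
      M / 2 ^ (∑ r, α r) * ((∏ r, ((α r : ℝ) + 1))⁻¹ *
        ∑ j ∈ Icc (1 : Fin p → ℕ) (fun _ => m), |gammaCoeff m j| * ∏ r, (j r : ℝ) ^ (α r + 1)) := by
  unfold gammaIntegral
  rw [mul_sum, mul_sum]
  refine (abs_sum_le_sum_abs _ _).trans (sum_le_sum fun j hj => ?_)
  have subset : centeredBox j ⊆ centeredBox fun _ => m := centeredBox_subset (mem_Icc.1 hj).2
  calc |gammaCoeff m j * ∫ w in centeredBox j, (∏ r, w r ^ α r) * φ w|
      ≤ |gammaCoeff m j| *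
          (M * ((2 ^ ∑ r, α r)⁻¹ * ∏ r, (j r : ℝ) ^ (α r + 1) / (α r + 1))) := by
        rw [abs_mul]
        gcongr
        exact abs_integral_centeredBox_prod_pow_mul_le (fun w hw => hφ w (subset hw)) α
    _ = _ := by
        rw [prod_div_distrib]
        ring

theorem abs_remainderTerm_le (hm : m ≠ 0) {φ : (Fin p → ℝ) → ℝ} {M : ℝ}
    (hφ : ∀ u ∈ centeredBox fun _ => m, |φ u| ≤ M) (α : Fin p → ℕ) :
    2 * m * |remainderTerm m α φ| ≤
      M / 2 ^ (∑ r, α r) * ((∏ r, ((α r : ℝ) + 1))⁻¹ *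
        ∑ j ∈ Icc (1 : Fin p → ℕ) (fun _ => m), |gammaCoeff m j| * ∏ r, (j r : ℝ) ^ (α r + 1)) := by
  set C := M / 2 ^ (∑ r, α r) * ((∏ r, ((α r : ℝ) + 1))⁻¹ *
    ∑ j ∈ Icc (1 : Fin p → ℕ) (fun _ => m), |gammaCoeff m j| * ∏ r, (j r : ℝ) ^ (α r + 1))
  have integral_weight : ∫ s in (0 : ℝ)..1, (1 - s) ^ (2 * m - 1) * C = (2 * m : ℝ)⁻¹ * C := by
    have cast_pred : ((2 * m - 1 : ℕ) : ℝ) + 1 = 2 * m := by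
      rw [← Nat.cast_add_one, Nat.sub_add_cancel (by lia)]
      push_cast
      rfl
    rw [intervalIntegral.integral_mul_const,
      intervalIntegral.integral_comp_sub_left (fun s => s ^ (2 * m - 1)), sub_self, sub_zero,
      integral_pow, cast_pred]
    simp
  have : (0 : ℝ) < 2 * m := by positivity
  rw [← le_inv_mul_iff₀ this, ← integral_weight, ← norm_eq_abs]
  refine intervalIntegral.norm_integral_le_of_norm_le zero_le_one
    (Eventually.of_forall fun s hs => ?_) (Continuous.intervalIntegrable (by fun_prop) _ _)
  rw [norm_mul, norm_pow, norm_eq_abs, norm_eq_abs, abs_of_nonneg (sub_nonneg.2 hs.2)]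
  gcongr
  · exact pow_nonneg (sub_nonneg.2 hs.2) _
  refine abs_gammaIntegral_prod_pow_mul_le (φ := fun w => φ (s • w)) (fun w hw => hφ _ ?_) α
  exact smul_mem_centeredBox hw (Set.Ioc_subset_Icc_self hs)

theorem abs_remainderOf_le (hm : m ≠ 0) {Φ : (Fin p → ℕ) → (Fin p → ℝ) → ℝ} {M : ℝ}
    (hΦ : ∀ α ∈ multiIndices p (2 * m), Continuous (Φ α))
    (hM : ∀ α ∈ multiIndices p (2 * m), ∀ u ∈ centeredBox fun _ => m, |Φ α u| ≤ M) :
    |remainderOf m Φ| ≤ remainderBound p m M := by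
  rw [remainderOf_eq_sum_remainderTerm hm hΦ, remainderBound, mul_sum]
  refine (abs_sum_le_sum_abs _ _).trans (sum_le_sum fun α hα => ?_)
  have factorial_succ : (∏ r, ((α r + 1).factorial : ℝ)) =
      (∏ r, ((α r : ℝ) + 1)) * ∏ r, ((α r).factorial : ℝ) := by
    simp only [Nat.factorial_succ, Nat.cast_mul, Nat.cast_add_one, prod_mul_distrib]
  have term_le := abs_remainderTerm_le hm (hM α hα) α
  rw [mem_multiIndices.1 hα] at term_le
  calc |2 * m / (∏ r, ((α r).factorial : ℝ)) * remainderTerm m α (Φ α)|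
      = (∏ r, ((α r).factorial : ℝ))⁻¹ * (2 * m * |remainderTerm m α (Φ α)|) := by
        rw [abs_mul, abs_of_nonneg (by positivity)]
        ring
    _ ≤ _ := mul_le_mul_of_nonneg_left term_le (by positivity)
    _ = _ := by
        rw [factorial_succ, one_div, mul_inv]
        ring

theorem remainderTerm_sub {φ ψ : (Fin p → ℝ) → ℝ} (hφ : Continuous φ) (hψ : Continuous ψ)
    (α : Fin p → ℕ) :
    remainderTerm m α (fun u => φ u - ψ u) = remainderTerm m α φ - remainderTerm m α ψ := by
  have integrable {φ : (Fin p → ℝ) → ℝ} (hφ : Continuous φ) :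
      IntervalIntegrable (fun s : ℝ => (1 - s) ^ (2 * m - 1) *
        gammaIntegral m fun w => (∏ r, w r ^ α r) * φ (s • w)) volume 0 1 := by
    have := continuous_gammaIntegral_prod_pow_mul (m := m) hφ α
    exact Continuous.intervalIntegrable (by fun_prop) 0 1
  unfold remainderTerm
  rw [← intervalIntegral.integral_sub (integrable hφ) (integrable hψ)]
  simp only [← mul_sub]
  congr! 3 with s
  simp only [mul_sub]
  rw [← gammaIntegral_sub (by fun_prop) (by fun_prop)]

theorem remainderOf_sub (hm : m ≠ 0) {Φ Ψ : (Fin p → ℕ) → (Fin p → ℝ) → ℝ}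
    (hΦ : ∀ α ∈ multiIndices p (2 * m), Continuous (Φ α))
    (hΨ : ∀ α ∈ multiIndices p (2 * m), Continuous (Ψ α)) :
    remainderOf m (fun α u => Φ α u - Ψ α u) = remainderOf m Φ - remainderOf m Ψ := by
  rw [remainderOf_eq_sum_remainderTerm hm hΦ, remainderOf_eq_sum_remainderTerm hm hΨ,
    remainderOf_eq_sum_remainderTerm hm (Φ := fun α u => Φ α u - Ψ α u)
      fun α hα => (hΦ α hα).sub (hΨ α hα), ← sum_sub_distrib]
  exact sum_congr rfl fun α hα => by rw [remainderTerm_sub (hΦ α hα) (hΨ α hα), mul_sub]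

theorem remainderOf_congr {Φ Ψ : (Fin p → ℕ) → (Fin p → ℝ) → ℝ}
    (h : ∀ α ∈ multiIndices p (2 * m), Set.EqOn (Φ α) (Ψ α) (centeredBox fun _ => m)) :
    remainderOf m Φ = remainderOf m Ψ := by
  have point_mem {j : Fin p → ℕ} (hj : ∀ r, j r ≤ m) {s : ℝ} (hs : s ∈ Set.Icc 0 1)
      {v : Fin p → ℝ} (hv : v ∈ Set.Icc (-1) 1) :
      (fun r => s * (j r : ℝ) * v r / 2) ∈ centeredBox fun _ => m := by
    rw [mul_mul_div_two_eq_smul]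
    refine centeredBox_subset hj (smul_mem_centeredBox ⟨fun r => ?_, fun r => ?_⟩ hs)
    · simpa using mul_le_mul_of_nonneg_left (hv.1 r) (by positivity : 0 ≤ (j r : ℝ) / 2)
    · simpa using mul_le_mul_of_nonneg_left (hv.2 r) (by positivity : 0 ≤ (j r : ℝ) / 2)
  unfold remainderOf
  congr! 2 with α hα
  refine congrArg (_ * ·) (intervalIntegral.integral_congr fun s hs => ?_)
  rw [Set.uIcc_of_le zero_le_one] at hs
  refine congrArg (_ * ·) (setIntegral_congr_fun measurableSet_Icc fun v hv => ?_)
  refine congrArg (_ * ·) (sum_congr rfl fun j hj => congrArg (gammaCoeff m j * _ * ·) ?_)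
  exact h α hα (point_mem (mem_Icc.1 hj).2 hs hv)

theorem tendsto_remainderOf_of_tendstoUniformly {ι : Type*} {l : Filter ι} [l.NeBot] (hm : m ≠ 0)
    {Ψ : ι → (Fin p → ℕ) → (Fin p → ℝ) → ℝ} {S : (Fin p → ℕ) → (Fin p → ℝ) → ℝ}
    (hΨ : ∀ i, ∀ α ∈ multiIndices p (2 * m), Continuous (Ψ i α))
    (hS : ∀ α ∈ multiIndices p (2 * m), TendstoUniformly (fun i => Ψ i α) (S α) l) :
    Tendsto (fun i => remainderOf m (Ψ i)) l (𝓝 (remainderOf m S)) := by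
  have continuous_limit (α : Fin p → ℕ) (hα : α ∈ multiIndices p (2 * m)) : Continuous (S α) :=
    (hS α hα).continuous (Frequently.of_forall fun i => hΨ i α hα)
  have remainderBound_mul (ε : ℝ) : remainderBound p m ε = remainderBound p m 1 * ε := by
    simp only [remainderBound]
    ring
  refine Metric.tendsto_nhds.2 fun δ hδ => ?_
  obtain ⟨ε, hε, bound_lt⟩ := exists_pos_mul_lt hδ (remainderBound p m 1)
  have uniformly_close : ∀ᶠ i in l, ∀ α ∈ multiIndices p (2 * m), ∀ u, |Ψ i α u - S α u| ≤ ε :=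
    (eventually_all_finset _).2 fun α hα =>
      (Metric.tendstoUniformly_iff.1 (hS α hα) ε hε).mono fun i close u => by
        rw [abs_sub_comm]
        exact (close u).le
  filter_upwards [uniformly_close] with i close
  rw [Real.dist_eq, ← remainderOf_sub hm (hΨ i) continuous_limit]
  refine (abs_remainderOf_le hm (fun α hα => (hΨ i α hα).sub (continuous_limit α hα))
    fun α hα u _ => close α hα u).trans_lt ?_
  rwa [remainderBound_mul]

theorem tendsto_remainderOf {ι : Type*} {l : Filter ι} [l.NeBot] (hm : m ≠ 0)
    {Ψ : ι → (Fin p → ℕ) → (Fin p → ℝ) → ℝ} {S : (Fin p → ℕ) → (Fin p → ℝ) → ℝ}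
    (hΨ : ∀ i, ∀ α ∈ multiIndices p (2 * m), Continuous (Ψ i α))
    (hS : ∀ α ∈ multiIndices p (2 * m),
      TendstoUniformlyOn (fun i => Ψ i α) (S α) l (centeredBox fun _ => m)) :
    Tendsto (fun i => remainderOf m (Ψ i)) l (𝓝 (remainderOf m S)) := by
  -- Clamping to the box makes the convergence uniform on the whole space, so that the limits,
  -- extended in this way, are continuous.
  let lower : Fin p → ℝ := -fun _ => (m : ℝ) / 2
  let upper : Fin p → ℝ := fun _ => (m : ℝ) / 2
  let clamp (u : Fin p → ℝ) : Fin p → ℝ := lower ⊔ (upper ⊓ u)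
  have clamp_mem (u : Fin p → ℝ) : clamp u ∈ centeredBox fun _ => m :=
    ⟨le_sup_left, sup_le (neg_le_self fun _ => by positivity) inf_le_left⟩
  have clamp_eq {u : Fin p → ℝ} (hu : u ∈ centeredBox fun _ => m) : clamp u = u := by
    change lower ⊔ (upper ⊓ u) = u
    rw [inf_eq_right.2 hu.2, sup_eq_right.2 hu.1]
  have continuous_clamp : Continuous clamp :=
    continuous_pi fun r => continuous_const.max (continuous_const.min (continuous_apply r))
  have remainderOf_clamp (Φ : (Fin p → ℕ) → (Fin p → ℝ) → ℝ) :
      remainderOf m (fun α => Φ α ∘ clamp) = remainderOf m Φ :=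
    remainderOf_congr fun α _ u hu => congrArg (Φ α) (clamp_eq hu)
  simp only [← remainderOf_clamp (Ψ _), ← remainderOf_clamp S]
  refine tendsto_remainderOf_of_tendstoUniformly hm
    (fun i α hα => (hΨ i α hα).comp continuous_clamp) fun α hα => ?_
  have := (hS α hα).comp clamp
  rwa [Set.eq_univ_of_forall (s := clamp ⁻¹' centeredBox fun _ => m) clamp_mem,
    tendstoUniformlyOn_univ] at this

end Remainder

/-! ### Passage to the limit -/

section Limits

variable {p : ℕ}

theorem eventually_minToInfty (hp : p ≠ 0) (K : ℕ) : ∀ᶠ n in minToInfty p, ∀ r, K ≤ n r := by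
  have : NeZero p := ⟨hp⟩
  filter_upwards [tendsto_comap.eventually (eventually_ge_atTop K)] with n hn r
  exact hn.trans (ciInf_le (OrderBot.bddBelow _) r)

theorem minToInfty_neBot (hp : p ≠ 0) : (minToInfty p).NeBot := by
  have : NeZero p := ⟨hp⟩
  refine comap_neBot fun t ht => ?_
  obtain ⟨K, hK⟩ := mem_atTop_sets.1 ht
  exact ⟨fun _ => K, hK _ (by rw [ciInf_const])⟩

theorem exists_of_eventually_maxToInfty {P : (Fin p → ℝ) → Prop}
    (h : ∀ᶠ x in maxToInfty p, P x) : ∃ K : ℝ, ∀ (x : Fin p → ℝ) (r : Fin p), K ≤ x r → P x := by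
  rw [maxToInfty, eventually_comap, eventually_atTop] at h
  obtain ⟨K, hK⟩ := h
  exact ⟨K, fun x r hr => hK _ (hr.trans (le_ciSup (Set.finite_range x).bddAbove r)) x rfl⟩

theorem eventually_forall_abs_restrictTo_sub_add_smul_le (hp : p ≠ 0) {g : (Fin p → ℝ) → ℝ}
    (hg : Tendsto g (maxToInfty p) (𝓝 0)) {J : Finset (Fin p)} (hJ : J.Nonempty)
    (c w : Fin p → ℝ) {ε : ℝ} (hε : 0 < ε) :
    ∀ᶠ n in minToInfty p, ∀ s ∈ Set.Icc (0 : ℝ) 1, |g (restrictTo J n - c + s • w)| ≤ ε := by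
  have eventually_le : ∀ᶠ x in maxToInfty p, |g x| ≤ ε := by
    filter_upwards [Metric.tendsto_nhds.1 hg ε hε] with x hx
    rw [dist_zero_right] at hx
    exact hx.le
  obtain ⟨K, hK⟩ := exists_of_eventually_maxToInfty eventually_le
  obtain ⟨r, hr⟩ := hJ
  filter_upwards [eventually_minToInfty hp ⌈K + c r + |w r|⌉₊] with n hn s hs
  refine hK _ r ?_
  have large : K + c r + |w r| ≤ n r := (Nat.le_ceil _).trans (mod_cast hn r)
  have step_ge : -|w r| ≤ s * w r := by
    refine neg_le_of_abs_le ?_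
    rw [abs_mul, abs_of_nonneg hs.1]
    exact mul_le_of_le_one_left (abs_nonneg _) hs.2
  simp only [Pi.add_apply, Pi.sub_apply, Pi.smul_apply, smul_eq_mul, restrictTo, if_pos hr]
  linarith

theorem abs_taylorRemainder_le {N : ℕ} {F : (Fin p → ℝ) → ℝ} {x w : Fin p → ℝ} {ε : ℝ}
    (h : ∀ α ∈ multiIndices p N, ∀ s ∈ Set.Icc (0 : ℝ) 1, |multiDeriv α F (x + s • w)| ≤ ε) :
    |taylorRemainder N F x w| ≤
      N * (∑ α ∈ multiIndices p N, ∏ q, |w q| ^ α q / (α q).factorial) * ε := by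
  have integrand_le (s : ℝ) (hs : s ∈ Set.Ioc (0 : ℝ) 1) :
      ‖(1 - s) ^ (N - 1) * taylorTerm N F (x + s • w) w‖ ≤
        (∑ α ∈ multiIndices p N, ∏ q, |w q| ^ α q / (α q).factorial) * ε := by
    have weight_le : |(1 - s) ^ (N - 1)| ≤ 1 := by
      rw [abs_of_nonneg (pow_nonneg (sub_nonneg.2 hs.2) _)]
      exact pow_le_one₀ (sub_nonneg.2 hs.2) (sub_le_self _ hs.1.le)
    rw [norm_mul]
    refine (mul_le_of_le_one_left (norm_nonneg _) weight_le).trans ?_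
    rw [sum_mul]
    refine (norm_sum_le _ _).trans (sum_le_sum fun α hα => ?_)
    simp only [norm_mul, norm_prod, norm_div, norm_pow, norm_eq_abs, Nat.abs_cast]
    exact mul_le_mul_of_nonneg_left (h α hα s (Set.Ioc_subset_Icc_self hs)) (by positivity)
  rw [taylorRemainder, abs_mul, Nat.abs_cast, mul_assoc]
  refine mul_le_mul_of_nonneg_left ?_ N.cast_nonneg
  rw [← Set.uIoc_of_le zero_le_one] at integrand_le
  simpa using intervalIntegral.norm_integral_le_of_norm_le_const integrand_le

theorem tendsto_taylorRemainder_restrictTo (hp : p ≠ 0) {N : ℕ} {F : (Fin p → ℝ) → ℝ}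
    (hF : ∀ α ∈ multiIndices p N, Tendsto (multiDeriv α F) (maxToInfty p) (𝓝 0))
    {J : Finset (Fin p)} (hJ : J.Nonempty) (c w : Fin p → ℝ) :
    Tendsto (fun n => taylorRemainder N F (restrictTo J n - c) w) (minToInfty p) (𝓝 0) := by
  refine Metric.tendsto_nhds.2 fun δ hδ => ?_
  obtain ⟨ε, hε, bound_lt⟩ := exists_pos_mul_lt hδ
    (N * ∑ α ∈ multiIndices p N, ∏ q, |w q| ^ α q / (α q).factorial)
  have small : ∀ᶠ n in minToInfty p, ∀ α ∈ multiIndices p N, ∀ s ∈ Set.Icc (0 : ℝ) 1,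
      |multiDeriv α F (restrictTo J n - c + s • w)| ≤ ε :=
    (eventually_all_finset _).2 fun α hα =>
      eventually_forall_abs_restrictTo_sub_add_smul_le hp (hF α hα) hJ c w hε
  filter_upwards [small] with n hn
  rw [dist_zero_right]
  exact (abs_taylorRemainder_le hn).trans_lt bound_lt

end Limits

section Boundary

variable {p : ℕ} {l l₀ : ℕ} {F : (Fin p → ℝ) → ℝ}

theorem gammaFunctional_taylorTerm_eq {k : ℕ} (h : k < 2 * l) (h₀ : k < 2 * l₀)
    (F : (Fin p → ℝ) → ℝ) (x : Fin p → ℝ) :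
    gammaFunctional p l (taylorTerm k F x) = gammaFunctional p l₀ (taylorTerm k F x) := by
  have expansion : taylorTerm k F x = ∑ α ∈ multiIndices p k,
      (multiDeriv α F x / ∏ q, ((α q).factorial : ℝ)) • fun w : Fin p → ℝ => ∏ q, w q ^ α q := by
    ext w
    simp only [taylorTerm, Finset.sum_apply, Pi.smul_apply, smul_eq_mul, prod_div_distrib]
    exact sum_congr rfl fun α _ => by ring
  simp only [expansion, map_sum, map_smul]
  refine sum_congr rfl fun α hα => ?_
  rw [← mem_multiIndices.1 hα] at h h₀
  rw [gammaFunctional_prod_pow_eq h h₀]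

theorem AJ_sub_AJ_eq (hl₀ : l₀ ≠ 0) (hl : l₀ ≤ l) (hF : ContDiff ℝ (2 * l₀ : ℕ) F)
    (J : Finset (Fin p)) (n : Fin p → ℕ) :
    AJ l F J n - AJ l₀ F J n = (gammaFunctional p l - gammaFunctional p l₀)
      (taylorRemainder (2 * l₀) F (restrictTo J n - 1 / 2)) := by
  have taylor : (fun w => F (restrictTo J n - 1 / 2 + w)) =
      ∑ k ∈ range (2 * l₀), taylorTerm k F (restrictTo J n - 1 / 2) +
        taylorRemainder (2 * l₀) F (restrictTo J n - 1 / 2) := by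
    ext w
    rw [Pi.add_apply, Finset.sum_apply]
    exact eq_sum_taylorTerm_add_taylorRemainder (by lia) hF _ w
  have polynomial_part : ∑ k ∈ range (2 * l₀),
      gammaFunctional p l (taylorTerm k F (restrictTo J n - 1 / 2)) =
      ∑ k ∈ range (2 * l₀), gammaFunctional p l₀ (taylorTerm k F (restrictTo J n - 1 / 2)) :=
    sum_congr rfl fun k hk => by
      rw [mem_range] at hk
      exact gammaFunctional_taylorTerm_eq (by lia) hk F _
  rw [AJ_eq_gammaFunctional, AJ_eq_gammaFunctional, taylor, map_add, map_add, map_sum, map_sum,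
    polynomial_part, add_sub_add_left_eq_sub, _root_.sub_apply]

theorem tendsto_AJ_sub_AJ (hp : p ≠ 0) (hl₀ : l₀ ≠ 0) (hl : l₀ ≤ l)
    (hF : ContDiff ℝ (2 * l₀ : ℕ) F)
    (hF0 : ∀ α ∈ multiIndices p (2 * l₀), Tendsto (multiDeriv α F) (maxToInfty p) (𝓝 0))
    {J : Finset (Fin p)} (hJ : J.Nonempty) :
    Tendsto (fun n => AJ l F J n - AJ l₀ F J n) (minToInfty p) (𝓝 0) := by
  have remainder_tendsto : Tendsto
      (fun n => taylorRemainder (2 * l₀) F (restrictTo J n - 1 / 2)) (minToInfty p) (𝓝 0) :=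
    tendsto_pi_nhds.2 fun w => tendsto_taylorRemainder_restrictTo hp hF0 hJ (1 / 2) w
  simp only [AJ_sub_AJ_eq hl₀ hl hF]
  rw [← map_zero (gammaFunctional p l - gammaFunctional p l₀)]
  exact ((gammaFunctional p l - gammaFunctional p l₀).continuous.tendsto 0).comp remainder_tendsto

theorem tendsto_tildeA_sub_tildeA (hp : p ≠ 0) (hl₀ : l₀ ≠ 0) (hl : l₀ ≤ l)
    (hF : ContDiff ℝ (2 * l₀ : ℕ) F)
    (hF0 : ∀ α ∈ multiIndices p (2 * l₀), Tendsto (multiDeriv α F) (maxToInfty p) (𝓝 0)) :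
    Tendsto (fun n => tildeA l F n - tildeA l₀ F n) (minToInfty p) (𝓝 0) := by
  simp only [tildeA, ← sum_sub_distrib, ← mul_sub]
  rw [← sum_eq_zero fun (J : Finset (Fin p)) (_ : J ∈ univ.erase ∅) =>
    mul_zero ((-1 : ℝ) ^ (p - #J))]
  exact tendsto_finsetSum _ fun J hJ => (tendsto_AJ_sub_AJ hp hl₀ hl hF hF0
    (nonempty_iff_ne_empty.2 (ne_of_mem_erase hJ))).const_mul _

end Boundary

section Summation

variable {p m : ℕ} {F f : (Fin p → ℝ) → ℝ}

theorem sum_gammaCoeff_mul_sum_shiftedSum_eq (m : ℕ) (F : (Fin p → ℝ) → ℝ) (n : Fin p → ℕ) :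
    ∑ j ∈ Icc (1 : Fin p → ℕ) (fun _ => m), gammaCoeff m j *
        ∑ J : Finset (Fin p), (-1) ^ (p - #J) *
          shiftedSum F n (fun r => if r ∈ J then (j r : ℝ) / 2 else -((j r : ℝ) / 2)) =
      tildeA m F n + (-1) ^ p * AJ m F ∅ 0 := by
  simp only [shiftedSum, sum_finset_neg_one_pow_mul_sum_box_swap]
  rw [← AJ_empty_eq_AJ_empty_zero m F n, tildeA]
  have empty_term : (-1 : ℝ) ^ p * AJ m F ∅ n = (-1) ^ (p - #(∅ : Finset (Fin p))) * AJ m F ∅ n :=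
    rfl
  rw [empty_term, sum_erase_add univ _ (mem_univ ∅)]
  simp only [AJ, mul_sum]
  rw [sum_comm]
  simp only [mul_left_comm (gammaCoeff m _)]

theorem sum_box_eq (hm : m ≠ 0) (hf : ContDiff ℝ (2 * m : ℕ) f) (hFf : IsAntiderivative F f)
    (n : Fin p → ℕ) :
    ∑ k ∈ box n, f (fun r => (k r : ℝ)) = tildeA m F n + (-1) ^ p * AJ m F ∅ 0 -
      remainderOf m fun α => shiftedSum (multiDeriv α f) n := by
  obtain ⟨L, hL, hall, hder⟩ := hFf.exists_isIteratedDeriv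
  have derivatives : remainderOf m (fun α => multiDeriv α (shiftedSum f n)) =
      remainderOf m fun α => shiftedSum (multiDeriv α f) n :=
    remainderOf_congr fun α hα u _ =>
      congrFun (multiDeriv_shiftedSum (by rwa [mem_multiIndices.1 hα]) n) u
  have apply_zero : ∑ k ∈ box n, f (fun r => (k r : ℝ)) = shiftedSum f n 0 := by
    simp only [shiftedSum, Pi.zero_apply, add_zero]
  rw [apply_zero, (hder.shiftedSum n).apply_zero_eq hm hL hall (contDiff_shiftedSum hf n),
    sum_gammaCoeff_mul_sum_shiftedSum_eq, derivatives]

theorem tendstoUniformlyOn_shiftedSeries (hp : p ≠ 0) {g S : (Fin p → ℝ) → ℝ}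
    {K : Set (Fin p → ℝ)} (h : TendstoUniformlyOn (shiftedSum g) S (minToInfty p) K) :
    TendstoUniformlyOn (shiftedSum g) (shiftedSeries g) (minToInfty p) K := by
  have := minToInfty_neBot hp
  exact h.congr_right fun u hu => (h.tendsto_at hu).limUnder_eq.symm

theorem tendsto_remainderOf_shiftedSum (hp : p ≠ 0) (hm : m ≠ 0) (hf : ContDiff ℝ (2 * m : ℕ) f)
    (hunif : ∀ α ∈ multiIndices p (2 * m), ∃ S : (Fin p → ℝ) → ℝ,
      TendstoUniformlyOn (shiftedSum (multiDeriv α f)) S (minToInfty p)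
        (centeredBox fun _ => m)) :
    Tendsto (fun n => remainderOf m fun α => shiftedSum (multiDeriv α f) n) (minToInfty p)
      (𝓝 (remainderInfty m f)) := by
  have := minToInfty_neBot hp
  refine tendsto_remainderOf hm (fun n α hα => continuous_shiftedSum ?_ n) fun α hα => ?_
  · exact continuous_multiDeriv (by rwa [mem_multiIndices.1 hα])
  · obtain ⟨S, hS⟩ := hunif α hα
    exact tendstoUniformlyOn_shiftedSeries hp hS

theorem tendsto_sum_box_sub_tildeA {m₀ : ℕ} (hp : p ≠ 0) (hm₀ : m₀ ≠ 0) (hm : m₀ ≤ m)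
    (hf : ContDiff ℝ (2 * m : ℕ) f) (hF : ContDiff ℝ (2 * m₀ : ℕ) F) (hFf : IsAntiderivative F f)
    (hF0 : ∀ α ∈ multiIndices p (2 * m₀), Tendsto (multiDeriv α F) (maxToInfty p) (𝓝 0))
    (hunif : ∀ α ∈ multiIndices p (2 * m), ∃ S : (Fin p → ℝ) → ℝ,
      TendstoUniformlyOn (shiftedSum (multiDeriv α f)) S (minToInfty p)
        (centeredBox fun _ => m)) :
    Tendsto (fun n => ∑ k ∈ box n, f (fun r => (k r : ℝ)) - tildeA m₀ F n) (minToInfty p)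
      (𝓝 ((-1) ^ p * AJ m F ∅ 0 - remainderInfty m f)) := by
  have boundary := tendsto_tildeA_sub_tildeA hp hm₀ hm hF hF0
  have remainder := tendsto_remainderOf_shiftedSum hp (by lia) hf hunif
  rw [← zero_add ((-1) ^ p * AJ m F ∅ 0 - remainderInfty m f)]
  refine (boundary.add (remainder.const_sub ((-1) ^ p * AJ m F ∅ 0))).congr fun n => ?_
  rw [sum_box_eq (by lia) hf hFf]
  ring

theorem abs_le_on_centeredBox {φ : (Fin p → ℝ) → ℝ} (hm : m ≠ 0) (hφ : Continuous φ) {M : ℝ}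
    (h : ∀ u : Fin p → ℝ, (∀ r, u r ∈ Set.Ioc (-((m : ℝ) / 2)) ((m : ℝ) / 2)) → |φ u| ≤ M) :
    ∀ u ∈ centeredBox fun _ => m, |φ u| ≤ M := by
  have : (0 : ℝ) < m / 2 := by positivity
  have closure_eq : closure (Set.univ.pi fun _ : Fin p =>
      Set.Ioc (-((m : ℝ) / 2)) ((m : ℝ) / 2)) = centeredBox fun _ => m := by
    rw [closure_pi_set, closure_Ioc (by linarith), Set.pi_univ_Icc]
    rfl
  have isClosed_le : IsClosed {u | |φ u| ≤ M} := isClosed_le (by fun_prop) continuous_const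
  intro u hu
  rw [← closure_eq] at hu
  refine closure_minimal (fun v hv => ?_) isClosed_le hu
  exact h v fun r => hv r (Set.mem_univ r)

theorem abs_remainderInfty_le (hp : p ≠ 0) (hm : m ≠ 0) (hf : ContDiff ℝ (2 * m : ℕ) f)
    (hunif : ∀ α ∈ multiIndices p (2 * m), ∃ S : (Fin p → ℝ) → ℝ,
      TendstoUniformlyOn (shiftedSum (multiDeriv α f)) S (minToInfty p)
        (centeredBox fun _ => m)) {M : ℝ}
    (hM : ∀ n, ∀ α ∈ multiIndices p (2 * m), ∀ u : Fin p → ℝ,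
      (∀ r, u r ∈ Set.Ioc (-((m : ℝ) / 2)) ((m : ℝ) / 2)) →
        |shiftedSum (multiDeriv α f) n u| ≤ M) :
    |remainderInfty m f| ≤ remainderBound p m M := by
  have := minToInfty_neBot hp
  have continuous_sum (n α) (hα : α ∈ multiIndices p (2 * m)) :
      Continuous (shiftedSum (multiDeriv α f) n) :=
    continuous_shiftedSum (continuous_multiDeriv (by rwa [mem_multiIndices.1 hα])) n
  refine le_of_tendsto (tendsto_remainderOf_shiftedSum hp hm hf hunif).abs
    (Eventually.of_forall fun n => abs_remainderOf_le hm (continuous_sum n) fun α hα => ?_)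
  exact abs_le_on_centeredBox hm (continuous_sum n α hα) (hM n α hα)

theorem nonneg_of_abs_shiftedSum_le (hp : p ≠ 0) (hm : m ≠ 0) {M : ℝ}
    (hM : ∀ n, ∀ α ∈ multiIndices p (2 * m), ∀ u : Fin p → ℝ,
      (∀ r, u r ∈ Set.Ioc (-((m : ℝ) / 2)) ((m : ℝ) / 2)) →
        |shiftedSum (multiDeriv α f) n u| ≤ M) : 0 ≤ M := by
  have : (0 : ℝ) < m / 2 := by positivity
  refine (abs_nonneg _).trans
    (hM 0 (Pi.single ⟨0, by lia⟩ (2 * m)) (by simp [mem_multiIndices]) 0 fun r => ?_)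
  rw [Pi.zero_apply, Set.mem_Ioc]
  constructor <;> linarith

end Summation

end AltSum

theorem theorem3p1 (p m₀ m : ℕ) (hp : 1 ≤ p) (hm₀ : 1 ≤ m₀) (hm : m₀ ≤ m)
    (f F : (Fin p → ℝ) → ℝ)
    (hf : ContDiff ℝ ((2 * m : ℕ) : WithTop ℕ∞) f)
    (hF : ContDiff ℝ ((2 * m₀ : ℕ) : WithTop ℕ∞) F)
    (hFf : AltSum.IsAntiderivative F f)
    (hF0 : ∀ α : Fin p → ℕ, ∑ r, α r = 2 * m₀ →
      Filter.Tendsto (AltSum.multiDeriv α F) (AltSum.maxToInfty p) (nhds 0))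
    (hunif : ∀ α : Fin p → ℕ, ∑ r, α r = 2 * m →
      ∃ S : (Fin p → ℝ) → ℝ,
        TendstoUniformlyOn (fun n u => AltSum.shiftedSum (AltSum.multiDeriv α f) n u) S
          (AltSum.minToInfty p) (Set.Icc (fun _ => -((m : ℝ) / 2)) (fun _ => (m : ℝ) / 2))) :
    -- the limit exists and has the stated value
    (Filter.Tendsto
        (fun n => (∑ k ∈ AltSum.box n, f (fun r => (k r : ℝ))) - AltSum.tildeA m₀ F n)
        (AltSum.minToInfty p)
        (nhds ((-1) ^ p * AltSum.AJ m F ∅ 0 - AltSum.remainderInfty m f)) ∧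
      AltSum.altSum m₀ F f = (-1) ^ p * AltSum.AJ m F ∅ 0 - AltSum.remainderInfty m f) ∧
    -- the alternative expressions of `A^J_{l,F}(n)`
    (∀ l : ℕ, 1 ≤ l → ∀ (J : Finset (Fin p)) (n : Fin p → ℕ),
      AltSum.AJ l F J n =
          ∑ β ∈ Finset.Icc (fun _ : Fin p => 1 - (l : ℤ)) (fun _ => (l : ℤ) - 1),
            AltSum.tauCoeff l (fun r => 1 + (β r).natAbs) *
              F (fun r => AltSum.restrictTo J n r - 1 / 2 - (β r : ℝ) / 2) ∧
      AltSum.AJ l F J n =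
          ∑ α ∈ Finset.Icc (0 : Fin p → ℕ) (fun _ => l - 1),
            AltSum.tauCoeff l (fun r => 1 + α r) *
              ∑ β ∈ AltSum.absFiber α,
                F (fun r => AltSum.restrictTo J n r - 1 / 2 - (β r : ℝ) / 2)) ∧
    -- the bounds on the remainder
    (∀ M : ℝ,
      (∀ (n : Fin p → ℕ) (α : Fin p → ℕ), ∑ r, α r = 2 * m →
        ∀ u : Fin p → ℝ, (∀ r, u r ∈ Set.Ioc (-((m : ℝ) / 2)) ((m : ℝ) / 2)) →
          |AltSum.shiftedSum (AltSum.multiDeriv α f) n u| ≤ M) →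
      |AltSum.remainderInfty m f| ≤ AltSum.remainderBound p m M ∧
      AltSum.remainderBound p m M ≤ AltSum.simpleBound 1.0331 p m M ∧
      (2 ≤ m → AltSum.remainderBound p m M ≤ AltSum.simpleBound 1.001 p m M)) ∧
    -- the values at `J = ∅` or `n = 0`
    (∀ l : ℕ, 1 ≤ l → ∀ (J : Finset (Fin p)) (n : Fin p → ℕ),
      AltSum.AJ l F ∅ 0 = AltSum.AJ l F ∅ n ∧
      AltSum.AJ l F ∅ 0 = AltSum.AJ l F J 0 ∧
      AltSum.AJ l F ∅ 0 =
        ∑ α ∈ Finset.Icc (0 : Fin p → ℕ) (fun _ => l - 1),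
          AltSum.tauCoeff l (fun r => 1 + α r) *
            ∑ β ∈ AltSum.absFiber α, F (fun r => (β r : ℝ) / 2 - 1 / 2)) := by
  have hp_ne : p ≠ 0 := by lia
  have hm_ne : m ≠ 0 := by lia
  simp only [← AltSum.mem_multiIndices] at hF0 hunif ⊢
  have hlim := AltSum.tendsto_sum_box_sub_tildeA hp_ne (by lia) hm hf hF hFf hF0 hunif
  refine ⟨⟨hlim, ?_⟩, fun l hl J n => ⟨?_, ?_⟩, fun M hM => ⟨?_, ?_⟩, fun l hl J n => ⟨?_, ?_, ?_⟩⟩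
  · have := AltSum.minToInfty_neBot hp_ne
    exact hlim.limUnder_eq
  · exact AltSum.AJ_eq_sum_tau l F J n
  · exact AltSum.AJ_eq_sum_absFiber (by lia) F J n
  · exact AltSum.abs_remainderInfty_le hp_ne hm_ne hf hunif hM
  · have hM_nonneg := AltSum.nonneg_of_abs_shiftedSum_le hp_ne hm_ne hM
    exact AltSum.remainderBound_le_simpleBound hp_ne hm_ne hM_nonneg
  · exact (AltSum.AJ_empty_eq_AJ_empty_zero l F n).symm
  · exact (AltSum.AJ_zero_eq_AJ_empty_zero l F J).symm
  · exact AltSum.AJ_empty_zero_eq_sum_absFiber (by lia) F
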